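/- A flow graph is a finite directed graph $G$ on the vertex set $[m]=\{1,\dots,m\}$, $m\ge 1$, parallel edges allowed, in which every edge is directed from a smaller to a larger vertex, $1$ is the only source and $m$ is the only sink. A framing $F$ of $G$ is a choice, for every vertex $v$, of a linear order on the set $\mathrm{In}(v)$ of edges entering $v$ and of a linear order on the set $\mathrm{Out}(v)$ of edges leaving $v$. A route is a directed path from $1$ to $m$. For a path $P$ through $v$ let $Pv$ and $vP$ be its maximal subpaths ending, respectively beginning, at $v$. For paths $P,Q$ through $v$ let $w$ be the first vertex after which $Pv$ and $Qv$ coincide; write $Pv<_{\mathcal I(v)}Qv$ if $w$ is the first vertex of neither of them and the edge of $P$ entering $w$ is smaller in $\mathrm{In}(w)$ than the edge of $Q$ entering $w$. Likewise let $w'$ be the last vertex before which $vP$ and $vQ$ coincide; write $vP<_{\mathcal O(v)}vQ$ if $w'$ is the last vertex of neither of them and the edge of $P$ leaving $w'$ is smaller in $\mathrm{Out}(w')$ than the edge of $Q$ leaving $w'$. The path $P$ is clockwise (cw) from $Q$ at $v$, written $P<^{\mathrm{cw}}_vQ$, if $Pv<_{\mathcal I(v)}Qv$ and $vQ<_{\mathcal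 O(v)}vP$. The paths $P$ and $Q$ are incoherent at $v$ if $v$ is an inner vertex of both (neither their first nor their last vertex) and $P<^{\mathrm{cw}}_vQ$ or $Q<^{\mathrm{cw}}_vP$; otherwise they are coherent at $v$. They are coherent if they are coherent at every common inner vertex. A clique is a set of pairwise coherent routes, and a maximal clique is a clique that is maximal under inclusion. For maximal cliques $C\ne C'$ say that $C'$ is obtained from $C$ by a ccw rotation if $C'=(C\setminus\{R\})\cup\{R'\}$ for routes $R\in C$, $R'\in C'$ with $R<^{\mathrm{cw}}_vR'$ at some vertex $v$. The framing poset of $(G,F)$ is the set of maximal cliques with the relation $\le$ that is the reflexive and transitive closure of the ccw rotations. **Theorem (Characterization of the partial order).** Let $C$ and $C'$ be maximal cliques of a framed graph $(G,F)$. Then $C\le C'$ in the framing poset if and only if $C$ is cw from $C'$, that is, for all routes $R\in C$ and $R'\in C'$ and every vertex $v$ on both $R$ and $R'$, either $R$ and $R'$ are coherent at $v$ or $R<^{\mathrm{cw}}_vR'$. -/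

import Mathlib

/-- A flow graph on the vertex set `{0, 1, …, n}` with edges indexed by `E` (parallel edges are
allowed): every edge goes from a smaller to a larger vertex (so `0` has no incoming and `n` no
outgoing edge), `0` is the only source and `n` is the only sink. -/
structure FlowGraph (n : ℕ) (E : Type*) where
  src : E → Fin (n + 1)
  tgt : E → Fin (n + 1)
  src_lt_tgt : ∀ e, src e < tgt e
  unique_source : ∀ v, (∀ e, tgt e ≠ v) → v = 0
  unique_sink : ∀ v, (∀ e, src e ≠ v) → v = Fin.last n

namespace FlowGraph

variable {n : ℕ} {E : Type*}

/-- `G.IsWalk u l w`: the edges of the list `l` are, in this order, the edges of a directed path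
from `u` to `w`. The empty list is the path of length `0`. -/
def IsWalk (G : FlowGraph n E) : Fin (n + 1) → List E → Fin (n + 1) → Prop
  | u, [], w => u = w
  | u, e :: l, w => G.src e = u ∧ G.IsWalk (G.tgt e) l w

/-- Directed paths in `G`, possibly of length `0`. -/
@[ext]
structure Path (G : FlowGraph n E) where
  start : Fin (n + 1)
  finish : Fin (n + 1)
  edges : List E
  isWalk : G.IsWalk start edges finish

variable {G : FlowGraph n E}

/-- `P.SplitAt v A B`: the path `P` passes through `v`, the subpath `Pv` of `P` from its first
vertex to `v` has the edges `A`, and the subpath `vP` from `v` to the last vertex has the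
edges `B`. -/
def Path.SplitAt (P : G.Path) (v : Fin (n + 1)) (A B : List E) : Prop :=
  P.edges = A ++ B ∧ G.IsWalk P.start A v ∧ G.IsWalk v B P.finish

/-- `v` is a vertex of the path `P`. -/
def Path.HasVertex (P : G.Path) (v : Fin (n + 1)) : Prop :=
  ∃ A B, P.SplitAt v A B

/-- `v` is an inner vertex of the path `P`: a vertex of `P` other than the first and the last. -/
def Path.IsInner (P : G.Path) (v : Fin (n + 1)) : Prop :=
  P.HasVertex v ∧ v ≠ P.start ∧ v ≠ P.finish

/-- A route is a path from the source to the sink. -/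
def Path.IsRoute (P : G.Path) : Prop :=
  P.start = 0 ∧ P.finish = Fin.last n

/-- A framing: at every vertex, a linear order on the incoming edges and a linear order on the
outgoing edges. -/
structure Framing (G : FlowGraph n E) where
  inOrder : ∀ v, LinearOrder {e : E // G.tgt e = v}
  outOrder : ∀ v, LinearOrder {e : E // G.src e = v}

namespace Framing

variable (F : G.Framing)

/-- The strict order on the incoming edges at a vertex, for two edges with the same target. -/
def inLT (e f : E) : Prop :=
  ∃ (v : Fin (n + 1)) (he : G.tgt e = v) (hf : G.tgt f = v), (F.inOrder v).lt ⟨e, he⟩ ⟨f, hf⟩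

/-- The strict order on the outgoing edges at a vertex, for two edges with the same source. -/
def outLT (e f : E) : Prop :=
  ∃ (v : Fin (n + 1)) (he : G.src e = v) (hf : G.src f = v), (F.outOrder v).lt ⟨e, he⟩ ⟨f, hf⟩

/-- The strict relation between two paths that end at the same vertex, given by their edges:
`M` is the part after which they coincide, and the edges `e`, `f` by which they enter the first
vertex of `M` satisfy `e < f`. It does not hold if `M` starts at the first vertex of one of the
two paths. -/
def pathInLT (A A' : List E) : Prop :=
  ∃ (X X' M : List E) (e f : E), A = X ++ e :: M ∧ A' = X' ++ f :: M ∧ F.inLT e f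

/-- The strict relation between two paths that begin at the same vertex, given by their edges:
`M` is the part before which they coincide, and the edges `e`, `f` by which they leave the last
vertex of `M` satisfy `e < f`. It does not hold if `M` ends at the last vertex of one of the
two paths. -/
def pathOutLT (B B' : List E) : Prop :=
  ∃ (M Y Y' : List E) (e f : E), B = M ++ e :: Y ∧ B' = M ++ f :: Y' ∧ F.outLT e f

/-- `P` is clockwise from `Q` at the common vertex `v`: `Pv < Qv` and `vQ < vP`. -/
def CwAt (v : Fin (n + 1)) (P Q : G.Path) : Prop :=
  ∃ A B A' B', P.SplitAt v A B ∧ Q.SplitAt v A' B' ∧ F.pathInLT A A' ∧ F.pathOutLT B' B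

/-- `P` and `Q` are incoherent at `v`. -/
def IncoherentAt (v : Fin (n + 1)) (P Q : G.Path) : Prop :=
  P.IsInner v ∧ Q.IsInner v ∧ (F.CwAt v P Q ∨ F.CwAt v Q P)

/-- `P` and `Q` are coherent at `v`. -/
def CoherentAt (v : Fin (n + 1)) (P Q : G.Path) : Prop :=
  ¬ F.IncoherentAt v P Q

/-- Two paths are coherent if they are coherent at each common inner vertex. -/
def Coherent (P Q : G.Path) : Prop :=
  ∀ v, P.IsInner v → Q.IsInner v → F.CoherentAt v P Q

/-- A clique is a set of pairwise coherent routes. -/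
def IsClique (C : Set G.Path) : Prop :=
  (∀ P ∈ C, P.IsRoute) ∧ ∀ P ∈ C, ∀ Q ∈ C, F.Coherent P Q

/-- The maximal cliques (with respect to inclusion). -/
def MaxClique : Type _ :=
  {C : Set G.Path // Maximal F.IsClique C}

/-- `C'` is obtained from `C ≠ C'` by a counterclockwise rotation: `C' = (C \ R) ∪ R'`, where the
route `R` of `C` is clockwise from the route `R'` of `C'` at some vertex. -/
def CcwRotation (C C' : F.MaxClique) : Prop :=
  C ≠ C' ∧ ∃ R ∈ C.1, ∃ R' ∈ C'.1, C'.1 = (C.1 \ {R}) ∪ {R'} ∧ ∃ v, F.CwAt v R R'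

/-- The order of the framing poset: the reflexive and transitive closure of the
counterclockwise rotations of maximal cliques. -/
def FramingLE : F.MaxClique → F.MaxClique → Prop :=
  Relation.ReflTransGen F.CcwRotation

/-- The set `C` of paths is cw from the set `C'` of paths: wherever a path of `C` and a path of
`C'` meet, they are coherent or the first one is clockwise from the second one. -/
def IsCwFrom (C C' : Set G.Path) : Prop :=
  ∀ P ∈ C, ∀ P' ∈ C', ∀ v, P.HasVertex v → P'.HasVertex v →
    F.CoherentAt v P P' ∨ F.CwAt v P P'

end Framing

end FlowGraph

/-! Fix a vertex `v`. The paths from the source to `v` are linearly ordered, and so are the paths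
from `v` to the sink. A route through `v` is thus a point of a product of two linear orders, and two
routes are coherent at `v` exactly when their points are comparable in the product order. A maximal
clique therefore gives a chain at every vertex. By maximality, initial paths coherent with it extend
to its routes (`exists_extension`), every edge is used (`exists_through_edge`), and consecutive
points of a chain differ in one coordinate only (`step`), since otherwise a mixed route could be
added.

For one implication, a single rotation makes the old clique cw from the new one
(`cwFrom_of_exchange`), and this relation is transitive (`CwFrom.trans`). For the other, if `C ≠ D`
and `C` is cw from `D`, then some vertex carries three consecutive routes `a ++ b`, `a ++ c`, `d ++
c` of `C` such that replacing `a ++ c` by `d ++ b` gives a maximal clique (`IsCorner.isMaxClique`)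
that is still cw from `D` (`exists_corner`). Being cw from is antisymmetric and there are finitely
many maximal cliques, so repeated rotation ends at `D`. -/

namespace FlowGraph

variable {n : ℕ} {E : Type*} {G : FlowGraph n E}

/-! ### Walks as edge lists -/

theorem isWalk_append {A B : List E} {u w : Fin (n + 1)} :
    G.IsWalk u (A ++ B) w ↔ ∃ v, G.IsWalk u A v ∧ G.IsWalk v B w := by
  induction A generalizing u with
  | nil => simp [IsWalk]
  | cons e A ih => simp only [List.cons_append, IsWalk, ih]; grind

theorem IsWalk.append {A B : List E} {u v w : Fin (n + 1)} (hA : G.IsWalk u A v)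
    (hB : G.IsWalk v B w) : G.IsWalk u (A ++ B) w :=
  isWalk_append.2 ⟨v, hA, hB⟩

theorem IsWalk.le {A : List E} {u v : Fin (n + 1)} (h : G.IsWalk u A v) : u ≤ v := by
  induction A generalizing u with
  | nil => exact le_of_eq h
  | cons e A ih => exact h.1 ▸ (G.src_lt_tgt e).le.trans (ih h.2)

theorem IsWalk.lt {A : List E} {u v : Fin (n + 1)} (h : G.IsWalk u A v) (hA : A ≠ []) :
    u < v := by
  cases A with
  | nil => exact absurd rfl hA
  | cons e A => exact h.1 ▸ (G.src_lt_tgt e).trans_le h.2.le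

theorem IsWalk.eq_nil {A : List E} {u : Fin (n + 1)} (h : G.IsWalk u A u) : A = [] := by
  by_contra hA
  exact lt_irrefl _ (h.lt hA)

theorem IsWalk.finish_unique {A : List E} {u v w : Fin (n + 1)} (h : G.IsWalk u A v)
    (h' : G.IsWalk u A w) : v = w := by
  induction A generalizing u with
  | nil => exact h.symm.trans h'
  | cons e A ih => exact ih h.2 h'.2

theorem IsWalk.right {A B : List E} {u v w : Fin (n + 1)} (h : G.IsWalk u (A ++ B) w)
    (hA : G.IsWalk u A v) : G.IsWalk v B w := by
  obtain ⟨v', h₁, h₂⟩ := isWalk_append.1 h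
  exact h₁.finish_unique hA ▸ h₂

theorem isWalk_concat {A : List E} {e : E} {u v : Fin (n + 1)} :
    G.IsWalk u (A ++ [e]) v ↔ G.IsWalk u A (G.src e) ∧ G.tgt e = v := by
  rw [isWalk_append]
  simp only [IsWalk]
  grind

theorem isWalk_append_cons {A B : List E} {e : E} {u w : Fin (n + 1)} :
    G.IsWalk u (A ++ e :: B) w ↔ G.IsWalk u A (G.src e) ∧ G.IsWalk (G.tgt e) B w := by
  rw [isWalk_append]
  simp only [IsWalk]
  grind

theorem IsWalk.split_unique {A B A' B' : List E} {u v : Fin (n + 1)} (hA : G.IsWalk u A v)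
    (hA' : G.IsWalk u A' v) (h : A ++ B = A' ++ B') : A = A' ∧ B = B' := by
  rcases List.append_eq_append_iff.1 h with ⟨D, rfl, rfl⟩ | ⟨D, rfl, rfl⟩
  · obtain rfl := (hA'.right hA).eq_nil
    simp
  · obtain rfl := (hA.right hA').eq_nil
    simp

theorem IsWalk.length_le {A : List E} {u v : Fin (n + 1)} (h : G.IsWalk u A v) :
    A.length + u.1 ≤ v.1 := by
  induction A generalizing u with
  | nil => cases h; simp
  | cons e A ih =>
    have h₁ := ih h.2
    have h₂ : (G.src e).1 < (G.tgt e).1 := G.src_lt_tgt e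
    rw [h.1] at h₂
    simp only [List.length_cons]
    omega

theorem finite_walks [Finite E] (G : FlowGraph n E) :
    {A : List E | ∃ u v, G.IsWalk u A v}.Finite := by
  refine (List.finite_length_le E n).subset ?_
  rintro A ⟨u, v, h⟩
  have := h.length_le
  have := v.2
  simp only [Set.mem_ofPred_eq]
  omega

theorem append_cons_append_cons {M M' Y Y' : List E} {e f : E}
    (h : M ++ e :: Y = M' ++ f :: Y') :
    (M = M' ∧ e = f ∧ Y = Y') ∨ (∃ N, M' = M ++ e :: N ∧ Y = N ++ f :: Y') ∨
      ∃ N, M = M' ++ f :: N ∧ Y' = N ++ e :: Y := by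
  rcases List.append_eq_append_iff.1 h with ⟨D, rfl, h'⟩ | ⟨D, rfl, h'⟩
  · cases D with
    | nil => simp_all
    | cons x D => rw [List.cons_append, List.cons.injEq] at h'; grind
  · cases D with
    | nil => simp_all
    | cons x D => rw [List.cons_append, List.cons.injEq] at h'; grind

/-! ### The linear orders on paths and their ranks -/

namespace Framing

variable (F : G.Framing)

theorem inLT.tgt_eq {F : G.Framing} {e f : E} (h : F.inLT e f) : G.tgt e = G.tgt f := by
  obtain ⟨v, he, hf, -⟩ := h
  exact he.trans hf.symm

theorem outLT.src_eq {F : G.Framing} {e f : E} (h : F.outLT e f) : G.src e = G.src f := by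
  obtain ⟨v, he, hf, -⟩ := h
  exact he.trans hf.symm

theorem inLT_irrefl (e : E) : ¬ F.inLT e e := by
  rintro ⟨v, he, _, h⟩
  let _ := F.inOrder v
  exact lt_irrefl _ h

theorem outLT_irrefl (e : E) : ¬ F.outLT e e := by
  rintro ⟨v, he, _, h⟩
  let _ := F.outOrder v
  exact lt_irrefl _ h

theorem inLT_trans {e f g : E} (h : F.inLT e f) (h' : F.inLT f g) : F.inLT e g := by
  obtain ⟨v, he, hf, h⟩ := h
  obtain ⟨w, hf', hg, h'⟩ := h'
  obtain rfl : v = w := hf.symm.trans hf'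
  let _ := F.inOrder v
  exact ⟨v, he, hg, lt_trans h h'⟩

theorem outLT_trans {e f g : E} (h : F.outLT e f) (h' : F.outLT f g) : F.outLT e g := by
  obtain ⟨v, he, hf, h⟩ := h
  obtain ⟨w, hf', hg, h'⟩ := h'
  obtain rfl : v = w := hf.symm.trans hf'
  let _ := F.outOrder v
  exact ⟨v, he, hg, lt_trans h h'⟩

theorem inLT_total {e f : E} (h : G.tgt e = G.tgt f) : e = f ∨ F.inLT e f ∨ F.inLT f e := by
  let _ := F.inOrder (G.tgt f)
  rcases lt_trichotomy (⟨e, h⟩ : {e : E // G.tgt e = G.tgt f}) ⟨f, rfl⟩ with h' | h' | h'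
  · exact .inr (.inl ⟨_, _, _, h'⟩)
  · exact .inl (congrArg Subtype.val h')
  · exact .inr (.inr ⟨_, _, _, h'⟩)

theorem outLT_total {e f : E} (h : G.src e = G.src f) : e = f ∨ F.outLT e f ∨ F.outLT f e := by
  let _ := F.outOrder (G.src f)
  rcases lt_trichotomy (⟨e, h⟩ : {e : E // G.src e = G.src f}) ⟨f, rfl⟩ with h' | h' | h'
  · exact .inr (.inl ⟨_, _, _, h'⟩)
  · exact .inl (congrArg Subtype.val h')
  · exact .inr (.inr ⟨_, _, _, h'⟩)

theorem pathOutLT_irrefl (B : List E) : ¬ F.pathOutLT B B := by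
  rintro ⟨M, Y, Y', e, f, rfl, h, hef⟩
  simp only [List.append_cancel_left_eq, List.cons.injEq] at h
  exact F.outLT_irrefl e (h.1 ▸ hef)

theorem pathOutLT_trans {A B C : List E} (h : F.pathOutLT A B) (h' : F.pathOutLT B C) :
    F.pathOutLT A C := by
  obtain ⟨M, Y, Y', e, f, rfl, rfl, h⟩ := h
  obtain ⟨M', Z, Z', e', f', heq, rfl, h'⟩ := h'
  rcases append_cons_append_cons heq with ⟨rfl, rfl, rfl⟩ | ⟨N, rfl, rfl⟩ | ⟨N, rfl, rfl⟩
  · exact ⟨M, Y, Z', e, f', rfl, rfl, F.outLT_trans h h'⟩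
  · exact ⟨M, Y, N ++ f' :: Z', e, f, rfl, by simp, h⟩
  · exact ⟨M', N ++ e :: Y, Z', e', f', by simp, rfl, h'⟩

theorem pathInLT_irrefl (B : List E) : ¬ F.pathInLT B B := by
  rintro ⟨X, X', M, e, f, rfl, h, hef⟩
  have h' := (List.append_inj' (s₁ := X ++ [e]) (t₁ := M) (s₂ := X' ++ [f]) (t₂ := M)
    (by simpa using h) rfl).1
  have h' := (List.append_inj' h' rfl).2
  simp only [List.cons.injEq, and_true] at h'
  exact F.inLT_irrefl e (h' ▸ hef)

theorem append_cons_append_cons' {M M' Y Y' : List E} {e f : E}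
    (h : Y ++ e :: M = Y' ++ f :: M') :
    (M = M' ∧ e = f ∧ Y = Y') ∨ (∃ N, M' = N ++ e :: M ∧ Y = Y' ++ f :: N) ∨
      ∃ N, M = N ++ f :: M' ∧ Y' = Y ++ e :: N := by
  rcases append_cons_append_cons h with ⟨rfl, rfl, rfl⟩ | ⟨N, rfl, rfl⟩ | ⟨N, rfl, rfl⟩
  · simp
  · exact .inr (.inr ⟨N, rfl, rfl⟩)
  · exact .inr (.inl ⟨N, rfl, rfl⟩)

theorem pathInLT_trans {A B C : List E} (h : F.pathInLT A B) (h' : F.pathInLT B C) :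
    F.pathInLT A C := by
  obtain ⟨Y, Y', M, e, f, rfl, rfl, h⟩ := h
  obtain ⟨Z, Z', M', e', f', heq, rfl, h'⟩ := h'
  rcases append_cons_append_cons' heq with ⟨rfl, rfl, rfl⟩ | ⟨N, rfl, rfl⟩ | ⟨N, rfl, rfl⟩
  · exact ⟨Y, Z', M, e, f', rfl, rfl, F.inLT_trans h h'⟩
  · exact ⟨Y, Z' ++ f' :: N, M, e, f, rfl, by simp, h⟩
  · exact ⟨Y ++ e :: N, Z', M', e', f', by simp, rfl, h'⟩

/-- Neither path is a proper initial part of the other, because both stop at the sink, which no edge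
leaves; so distinct paths branch somewhere. -/
theorem pathOutLT_total {B B' : List E} {v : Fin (n + 1)} (hB : G.IsWalk v B (Fin.last n))
    (hB' : G.IsWalk v B' (Fin.last n)) : B = B' ∨ F.pathOutLT B B' ∨ F.pathOutLT B' B := by
  induction B generalizing v B' with
  | nil => obtain rfl : v = Fin.last n := hB
           exact .inl hB'.eq_nil.symm
  | cons e B ih =>
    cases B' with
    | nil => obtain rfl : v = Fin.last n := hB'
             exact .inl hB.eq_nil
    | cons f B' =>
      rcases F.outLT_total (hB.1.trans hB'.1.symm) with rfl | h | h
      · rcases ih hB.2 hB'.2 with rfl | ⟨M, Y, Y', g, k, rfl, rfl, h⟩ |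
          ⟨M, Y, Y', g, k, rfl, rfl, h⟩
        · exact .inl rfl
        · exact .inr (.inl ⟨e :: M, Y, Y', g, k, rfl, rfl, h⟩)
        · exact .inr (.inr ⟨e :: M, Y, Y', g, k, rfl, rfl, h⟩)
      · exact .inr (.inl ⟨[], B, B', e, f, rfl, rfl, h⟩)
      · exact .inr (.inr ⟨[], B', B, f, e, rfl, rfl, h⟩)

theorem pathInLT_total {A A' : List E} {v : Fin (n + 1)} (hA : G.IsWalk 0 A v)
    (hA' : G.IsWalk 0 A' v) : A = A' ∨ F.pathInLT A A' ∨ F.pathInLT A' A := by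
  induction A using List.reverseRecOn generalizing v A' with
  | nil => obtain rfl : 0 = v := hA
           exact .inl hA'.eq_nil.symm
  | append_singleton A e ih =>
    rcases List.eq_nil_or_concat A' with rfl | ⟨A', f, rfl⟩
    · obtain rfl : 0 = v := hA'
      exact .inl hA.eq_nil
    · rw [List.concat_eq_append] at hA' ⊢
      rw [isWalk_concat] at hA hA'
      rcases F.inLT_total (hA.2.trans hA'.2.symm) with rfl | h | h
      · rcases ih hA.1 hA'.1 with rfl | ⟨X, X', M, g, k, rfl, rfl, h⟩ |
          ⟨X, X', M, g, k, rfl, rfl, h⟩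
        · exact .inl rfl
        · exact .inr (.inl ⟨X, X', M ++ [e], g, k, by simp, by simp, h⟩)
        · exact .inr (.inr ⟨X, X', M ++ [e], g, k, by simp, by simp, h⟩)
      · exact .inr (.inl ⟨A, A', [], e, f, rfl, rfl, h⟩)
      · exact .inr (.inr ⟨A', A, [], f, e, rfl, rfl, h⟩)

theorem pathOutLT_append_left {B B' : List E} (M : List E) (h : F.pathOutLT B B') :
    F.pathOutLT (M ++ B) (M ++ B') := by
  obtain ⟨N, Y, Y', e, f, rfl, rfl, h⟩ := h
  exact ⟨M ++ N, Y, Y', e, f, by simp, by simp, h⟩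

/-- The number of paths that end where `A` ends and are smaller than `A`. -/
noncomputable def inRank (A : List E) : ℕ :=
  {A' : List E | (∃ u v, G.IsWalk u A' v) ∧ F.pathInLT A' A}.ncard

/-- The number of paths that start where `B` starts and are smaller than `B`. -/
noncomputable def outRank (B : List E) : ℕ :=
  {B' : List E | (∃ u v, G.IsWalk u B' v) ∧ F.pathOutLT B' B}.ncard

/-- The number of edges that leave the source of `e` and are smaller than `e`. -/
noncomputable def edgeRank (e : E) : ℕ :=
  {f : E | F.outLT f e}.ncard

variable [Finite E]

theorem inRank_lt_of {A A' : List E} {v : Fin (n + 1)} (hA : G.IsWalk 0 A v)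
    (h : F.pathInLT A A') : F.inRank A < F.inRank A' := by
  refine Set.ncard_lt_ncard ⟨fun B hB => ⟨hB.1, F.pathInLT_trans hB.2 h⟩, fun hs => ?_⟩
    (G.finite_walks.subset fun _ h => h.1)
  exact F.pathInLT_irrefl A (hs ⟨⟨_, _, hA⟩, h⟩).2

theorem outRank_lt_of {B B' : List E} {v w : Fin (n + 1)} (hB : G.IsWalk v B w)
    (h : F.pathOutLT B B') : F.outRank B < F.outRank B' := by
  refine Set.ncard_lt_ncard ⟨fun A hA => ⟨hA.1, F.pathOutLT_trans hA.2 h⟩, fun hs => ?_⟩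
    (G.finite_walks.subset fun _ h => h.1)
  exact F.pathOutLT_irrefl B (hs ⟨⟨_, _, hB⟩, h⟩).2

theorem edgeRank_lt_of {e f : E} (h : F.outLT e f) : F.edgeRank e < F.edgeRank f := by
  refine Set.ncard_lt_ncard ⟨fun A hA => F.outLT_trans hA h, fun hs => ?_⟩ (Set.toFinite _)
  exact F.outLT_irrefl e (hs h)

/-- Totality supplies the converse of `inRank_lt_of`. Comparisons of paths at a vertex thereby
become inequalities between natural numbers, open to linear arithmetic. -/
theorem inRank_lt {A A' : List E} {v : Fin (n + 1)} (hA : G.IsWalk 0 A v)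
    (hA' : G.IsWalk 0 A' v) : F.inRank A < F.inRank A' ↔ F.pathInLT A A' := by
  refine ⟨fun h => ?_, F.inRank_lt_of hA⟩
  rcases F.pathInLT_total hA hA' with rfl | h' | h'
  · exact absurd h (lt_irrefl _)
  · exact h'
  · exact absurd h (F.inRank_lt_of hA' h').le.not_gt

theorem outRank_lt {B B' : List E} {v : Fin (n + 1)} (hB : G.IsWalk v B (Fin.last n))
    (hB' : G.IsWalk v B' (Fin.last n)) : F.outRank B < F.outRank B' ↔ F.pathOutLT B B' := by
  refine ⟨fun h => ?_, F.outRank_lt_of hB⟩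
  rcases F.pathOutLT_total hB hB' with rfl | h' | h'
  · exact absurd h (lt_irrefl _)
  · exact h'
  · exact absurd h (F.outRank_lt_of hB' h').le.not_gt

theorem edgeRank_lt {e f : E} (h : G.src e = G.src f) :
    F.edgeRank e < F.edgeRank f ↔ F.outLT e f := by
  refine ⟨fun h' => ?_, F.edgeRank_lt_of⟩
  rcases F.outLT_total h with rfl | h | h
  · exact absurd h' (lt_irrefl _)
  · exact h
  · exact absurd h' (F.edgeRank_lt_of h).le.not_gt

theorem inRank_inj {A A' : List E} {v : Fin (n + 1)} (hA : G.IsWalk 0 A v)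
    (hA' : G.IsWalk 0 A' v) (h : F.inRank A = F.inRank A') : A = A' := by
  rcases F.pathInLT_total hA hA' with h' | h' | h'
  · exact h'
  · exact absurd h (F.inRank_lt_of hA h').ne
  · exact absurd h (F.inRank_lt_of hA' h').ne'

theorem outRank_inj {B B' : List E} {v : Fin (n + 1)} (hB : G.IsWalk v B (Fin.last n))
    (hB' : G.IsWalk v B' (Fin.last n)) (h : F.outRank B = F.outRank B') : B = B' := by
  rcases F.pathOutLT_total hB hB' with h' | h' | h'
  · exact h'
  · exact absurd h (F.outRank_lt_of hB h').ne
  · exact absurd h (F.outRank_lt_of hB' h').ne'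

/-- The first edges of smaller paths are not larger. -/
theorem edgeRank_le {e f : E} {Y Y' : List E} {v : Fin (n + 1)}
    (hB : G.IsWalk v (e :: Y) (Fin.last n)) (hB' : G.IsWalk v (f :: Y') (Fin.last n))
    (h : F.outRank (e :: Y) ≤ F.outRank (f :: Y')) : F.edgeRank e ≤ F.edgeRank f := by
  by_contra! h'
  rw [F.edgeRank_lt (hB'.1.trans hB.1.symm)] at h'
  exact h.not_gt (F.outRank_lt_of hB' ⟨[], Y', Y, f, e, rfl, rfl, h'⟩)

end Framing
end FlowGraph

/-! ### Conflicts, chains at a vertex and extension of initial paths -/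

namespace FlowGraph

variable {n : ℕ} {E : Type*} {G : FlowGraph n E}

theorem append_eq_append_cons_append_cons {A B X M Y : List E} {e g : E}
    (h : A ++ B = X ++ e :: (M ++ g :: Y)) :
    (∃ D, B = D ++ e :: (M ++ g :: Y)) ∨ (∃ D, A = X ++ e :: (M ++ g :: D)) ∨
      ∃ M₁ M₂, M = M₁ ++ M₂ ∧ A = X ++ e :: M₁ ∧ B = M₂ ++ g :: Y := by
  rcases List.append_eq_append_iff.1 h with ⟨D, rfl, h'⟩ | ⟨D, rfl, h'⟩
  · exact .inl ⟨D, h'⟩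
  · cases D with
    | nil => exact .inl ⟨[], h'.symm⟩
    | cons x D =>
      rw [List.cons_append, List.cons.injEq] at h'
      obtain ⟨rfl, h'⟩ := h'
      rcases List.append_eq_append_iff.1 h' with ⟨D', rfl, h₂⟩ | ⟨D', rfl, h₂⟩
      · cases D' with
        | nil => exact .inr (.inr ⟨M, [], by simp, by simp, h₂.symm⟩)
        | cons y D' =>
          rw [List.cons_append, List.cons.injEq] at h₂
          obtain ⟨rfl, h₂⟩ := h₂
          exact .inr (.inl ⟨D', rfl⟩)
      · exact .inr (.inr ⟨D, D', rfl, rfl, h₂⟩)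

namespace Framing

variable (F : G.Framing)

/-- The path with edges `l` is clockwise from the path with edges `l'` at some common vertex. -/
def Cw (l l' : List E) : Prop :=
  ∃ (X X' M Y Y' : List E) (e f g h : E), l = X ++ e :: (M ++ g :: Y) ∧
    l' = X' ++ f :: (M ++ h :: Y') ∧ F.inLT e f ∧ F.outLT h g

variable {F}

theorem Cw.append_right {A A' : List E} (h : F.Cw A A') (B : List E) : F.Cw (A ++ B) A' := by
  obtain ⟨X, X', M, Y, Y', e, f, g, h, rfl, rfl, h₁, h₂⟩ := h
  exact ⟨X, X', M, Y ++ B, Y', e, f, g, h, by simp, rfl, h₁, h₂⟩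

theorem Cw.append_right' {A A' : List E} (h : F.Cw A A') (B : List E) : F.Cw A (A' ++ B) := by
  obtain ⟨X, X', M, Y, Y', e, f, g, h, rfl, rfl, h₁, h₂⟩ := h
  exact ⟨X, X', M, Y, Y' ++ B, e, f, g, h, rfl, by simp, h₁, h₂⟩

theorem Cw.append_left {B B' : List E} (h : F.Cw B B') (A : List E) : F.Cw (A ++ B) B' := by
  obtain ⟨X, X', M, Y, Y', e, f, g, h, rfl, rfl, h₁, h₂⟩ := h
  exact ⟨A ++ X, X', M, Y, Y', e, f, g, h, by simp, rfl, h₁, h₂⟩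

theorem Cw.append_left' {B B' : List E} (h : F.Cw B B') (A : List E) : F.Cw B (A ++ B') := by
  obtain ⟨X, X', M, Y, Y', e, f, g, h, rfl, rfl, h₁, h₂⟩ := h
  exact ⟨X, A ++ X', M, Y, Y', e, f, g, h, rfl, by simp, h₁, h₂⟩

theorem cw_append {A B A' B' : List E} (hA : F.pathInLT A A') (hB : F.pathOutLT B' B) :
    F.Cw (A ++ B) (A' ++ B') := by
  obtain ⟨X, X', M, e, f, rfl, rfl, h₁⟩ := hA
  obtain ⟨M', Y', Y, h, g, rfl, rfl, h₂⟩ := hB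
  exact ⟨X, X', M ++ M', Y, Y', e, f, g, h, by simp, by simp, h₁, h₂⟩

/-- A conflict of `A ++ B` with `S` is a conflict of `A`, a conflict of `B`, or it takes place at
the vertex where `A` and `B` are joined. -/
theorem Cw.split {A B S : List E} {a u v w : Fin (n + 1)} (h : F.Cw (A ++ B) S)
    (hA : G.IsWalk a A v) (hS : G.IsWalk u S w) :
    F.Cw A S ∨ F.Cw B S ∨ ∃ A' B', S = A' ++ B' ∧ G.IsWalk u A' v ∧ G.IsWalk v B' w ∧
      F.pathInLT A A' ∧ F.pathOutLT B' B := by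
  obtain ⟨X, X', M, Y, Y', e, f, g, h, h₀, rfl, h₁, h₂⟩ := h
  rcases append_eq_append_cons_append_cons h₀ with ⟨D, rfl⟩ | ⟨D, rfl⟩ | ⟨M₁, M₂, rfl, rfl, rfl⟩
  · exact .inr (.inl ⟨D, X', M, Y, Y', e, f, g, h, rfl, rfl, h₁, h₂⟩)
  · exact .inl ⟨X, X', M, D, Y', e, f, g, h, rfl, rfl, h₁, h₂⟩
  · rw [isWalk_append_cons] at hA
    have hA' : G.IsWalk u (X' ++ f :: M₁) v :=
      isWalk_append_cons.2 ⟨(isWalk_append_cons.1 hS).1, h₁.tgt_eq ▸ hA.2⟩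
    have h₃ : X' ++ f :: ((M₁ ++ M₂) ++ h :: Y') = (X' ++ f :: M₁) ++ (M₂ ++ h :: Y') := by simp
    exact .inr (.inr ⟨X' ++ f :: M₁, M₂ ++ h :: Y', h₃, hA', (h₃ ▸ hS).right hA',
      ⟨X, X', M₁, e, f, rfl, rfl, h₁⟩, ⟨M₂, Y', Y, h, g, rfl, rfl, h₂⟩⟩)

theorem Cw.split' {A B S : List E} {a u v w : Fin (n + 1)} (h : F.Cw S (A ++ B))
    (hA : G.IsWalk a A v) (hS : G.IsWalk u S w) :
    F.Cw S A ∨ F.Cw S B ∨ ∃ A' B', S = A' ++ B' ∧ G.IsWalk u A' v ∧ G.IsWalk v B' w ∧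
      F.pathInLT A' A ∧ F.pathOutLT B B' := by
  obtain ⟨X', X, M, Y', Y, f, e, h, g, rfl, h₀, h₁, h₂⟩ := h
  rcases append_eq_append_cons_append_cons h₀ with ⟨D, rfl⟩ | ⟨D, rfl⟩ | ⟨M₁, M₂, rfl, rfl, rfl⟩
  · exact .inr (.inl ⟨X', D, M, Y', Y, f, e, h, g, rfl, rfl, h₁, h₂⟩)
  · exact .inl ⟨X', X, M, Y', D, f, e, h, g, rfl, rfl, h₁, h₂⟩
  · rw [isWalk_append_cons] at hA
    have hA' : G.IsWalk u (X' ++ f :: M₁) v :=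
      isWalk_append_cons.2 ⟨(isWalk_append_cons.1 hS).1, h₁.tgt_eq ▸ hA.2⟩
    have h₃ : X' ++ f :: ((M₁ ++ M₂) ++ h :: Y') = (X' ++ f :: M₁) ++ (M₂ ++ h :: Y') := by simp
    exact .inr (.inr ⟨X' ++ f :: M₁, M₂ ++ h :: Y', h₃, hA', (h₃ ▸ hS).right hA',
      ⟨X', X, M₁, f, e, rfl, rfl, h₁⟩, ⟨M₂, Y, Y', g, h, rfl, rfl, h₂⟩⟩)

/-- A conflict of two paths takes place at some common inner vertex. -/
theorem Cw.exists_vertex {l l' : List E} {a u b w : Fin (n + 1)} (h : F.Cw l l')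
    (hl : G.IsWalk a l u) (hl' : G.IsWalk b l' w) :
    ∃ v < u, v < w ∧ ∃ A B A' B', l = A ++ B ∧ l' = A' ++ B' ∧ G.IsWalk a A v ∧ G.IsWalk v B u ∧
      G.IsWalk b A' v ∧ G.IsWalk v B' w ∧ F.pathInLT A A' ∧ F.pathOutLT B' B := by
  obtain ⟨X, X', M, Y, Y', e, f, g, h, rfl, rfl, h₁, h₂⟩ := h
  have e₁ : X ++ e :: (M ++ g :: Y) = (X ++ e :: M) ++ g :: Y := by simp
  have e₂ : X' ++ f :: (M ++ h :: Y') = (X' ++ f :: M) ++ h :: Y' := by simp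
  rw [e₁] at hl
  rw [e₂] at hl'
  have w₁ := (isWalk_append_cons.1 hl).1
  have w₂ := (isWalk_append_cons.1 hl').1
  rw [h₂.src_eq] at w₂
  have w₃ := hl.right w₁
  have w₄ := hl'.right w₂
  exact ⟨G.src g, w₃.lt (by simp), w₄.lt (by simp), _, _, _, _, e₁, e₂, w₁, w₃, w₂, w₄,
    ⟨X, X', M, e, f, rfl, rfl, h₁⟩, ⟨[], Y', Y, h, g, rfl, rfl, h₂⟩⟩

theorem not_cw_self {l : List E} {a u : Fin (n + 1)} (hl : G.IsWalk a l u) : ¬ F.Cw l l := by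
  intro h
  obtain ⟨v, -, -, A, B, A', B', rfl, h', h₁, -, h₂, -, h₃, -⟩ := h.exists_vertex hl hl
  obtain ⟨rfl, -⟩ := h₁.split_unique h₂ h'
  exact F.pathInLT_irrefl A h₃

variable (F)

/-- Maximal cliques, as sets of edge lists. -/
structure IsMaxClique (C : Set (List E)) : Prop where
  walk : ∀ l ∈ C, G.IsWalk 0 l (Fin.last n)
  not_cw : ∀ l ∈ C, ∀ l' ∈ C, ¬ F.Cw l l'
  mem : ∀ l, G.IsWalk 0 l (Fin.last n) → (∀ l' ∈ C, ¬ F.Cw l l' ∧ ¬ F.Cw l' l) → l ∈ C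

/-- The set `C` is cw from the set `D`. -/
def CwFrom (C D : Set (List E)) : Prop :=
  ∀ l ∈ C, ∀ l' ∈ D, ¬ F.Cw l' l

/-- The path `A` to `v`, followed by the path `B` from `v`, is a route in `C`. -/
def _root_.FlowGraph.Through (G : FlowGraph n E) (C : Set (List E)) (v : Fin (n + 1))
    (A B : List E) : Prop :=
  G.IsWalk 0 A v ∧ G.IsWalk v B (Fin.last n) ∧ A ++ B ∈ C

variable {F}

theorem _root_.FlowGraph.finite_through [Finite E] (G : FlowGraph n E) (C : Set (List E))
    (v : Fin (n + 1)) : {x : List E × List E | G.Through C v x.1 x.2}.Finite := by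
  refine (G.finite_walks.prod G.finite_walks).subset ?_
  rintro ⟨A, B⟩ ⟨h₁, h₂, -⟩
  exact ⟨⟨_, _, h₁⟩, ⟨_, _, h₂⟩⟩

-- The sum of the two ranks is strictly monotone for the product order, so on the chain of a maximal
-- clique it selects the largest element.
variable [Finite E] (F) in
theorem exists_max_through (C : Set (List E)) (v : Fin (n + 1)) (p : List E → List E → Prop)
    (h : ∃ A B, G.Through C v A B ∧ p A B) : ∃ A B, G.Through C v A B ∧ p A B ∧
      ∀ A' B', G.Through C v A' B' → p A' B' →
        F.inRank A' + F.outRank B' ≤ F.inRank A + F.outRank B := by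
  obtain ⟨A, B, h⟩ := h
  obtain ⟨⟨A, B⟩, h₁, h₂⟩ := Set.exists_max_image
    {x : List E × List E | G.Through C v x.1 x.2 ∧ p x.1 x.2}
    (fun x => F.inRank x.1 + F.outRank x.2) ((G.finite_through C v).subset fun _ h => h.1)
    ⟨(A, B), h⟩
  exact ⟨A, B, h₁.1, h₁.2, fun A' B' h h' => h₂ (A', B') ⟨h, h'⟩⟩

variable [Finite E] (F) in
theorem exists_min_through (C : Set (List E)) (v : Fin (n + 1)) (p : List E → List E → Prop)
    (h : ∃ A B, G.Through C v A B ∧ p A B) : ∃ A B, G.Through C v A B ∧ p A B ∧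
      ∀ A' B', G.Through C v A' B' → p A' B' →
        F.inRank A + F.outRank B ≤ F.inRank A' + F.outRank B' := by
  obtain ⟨A, B, h⟩ := h
  obtain ⟨⟨A, B⟩, h₁, h₂⟩ := Set.exists_min_image
    {x : List E × List E | G.Through C v x.1 x.2 ∧ p x.1 x.2}
    (fun x => F.inRank x.1 + F.outRank x.2) ((G.finite_through C v).subset fun _ h => h.1)
    ⟨(A, B), h⟩
  exact ⟨A, B, h₁.1, h₁.2, fun A' B' h h' => h₂ (A', B') ⟨h, h'⟩⟩

namespace IsMaxClique

variable {C : Set (List E)}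

theorem prefix_coherent (hC : F.IsMaxClique C) {A B : List E} (h : A ++ B ∈ C) :
    ∀ S ∈ C, ¬ F.Cw A S ∧ ¬ F.Cw S A := fun _ hS =>
  ⟨fun h' => hC.not_cw _ h _ hS (h'.append_right B),
    fun h' => hC.not_cw _ hS _ h (h'.append_right' B)⟩

theorem suffix_coherent (hC : F.IsMaxClique C) {A B : List E} (h : A ++ B ∈ C) :
    ∀ S ∈ C, ¬ F.Cw B S ∧ ¬ F.Cw S B := fun _ hS =>
  ⟨fun h' => hC.not_cw _ h _ hS (h'.append_left A),
    fun h' => hC.not_cw _ hS _ h (h'.append_left' A)⟩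

end IsMaxClique

variable [Finite E]

/-- Local form of incoherence in terms of ranks. -/
theorem cw_of_rank {A B A' B' : List E} {v : Fin (n + 1)} (hA : G.IsWalk 0 A v)
    (hB : G.IsWalk v B (Fin.last n)) (hA' : G.IsWalk 0 A' v) (hB' : G.IsWalk v B' (Fin.last n))
    (h : F.inRank A < F.inRank A') (h' : F.outRank B' < F.outRank B) :
    F.Cw (A ++ B) (A' ++ B') :=
  cw_append ((F.inRank_lt hA hA').1 h) ((F.outRank_lt hB' hB).1 h')

namespace IsMaxClique

variable {C D : Set (List E)}

/-- This is the chain property in the product order: together with its mirror image it makes any two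
routes through `v` comparable. -/
theorem chain (hC : F.IsMaxClique C) {v : Fin (n + 1)} {A B A' B' : List E}
    (h : G.Through C v A B) (h' : G.Through C v A' B') :
    ¬ (F.inRank A < F.inRank A' ∧ F.outRank B' < F.outRank B) := fun h₀ =>
  hC.not_cw _ h.2.2 _ h'.2.2 (cw_of_rank h.1 h.2.1 h'.1 h'.2.1 h₀.1 h₀.2)

/-- A path to `v` and a path from `v` form a route of the maximal clique if they are coherent with
all its routes, and their concatenation is coherent with them at `v`. -/
theorem append_mem (hC : F.IsMaxClique C) {v : Fin (n + 1)} {A B : List E}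
    (hA : G.IsWalk 0 A v) (hB : G.IsWalk v B (Fin.last n))
    (hA' : ∀ S ∈ C, ¬ F.Cw A S ∧ ¬ F.Cw S A) (hB' : ∀ S ∈ C, ¬ F.Cw B S ∧ ¬ F.Cw S B)
    (h : ∀ A' B', G.Through C v A' B' →
      ¬ (F.inRank A < F.inRank A' ∧ F.outRank B' < F.outRank B) ∧
      ¬ (F.inRank A' < F.inRank A ∧ F.outRank B < F.outRank B')) : A ++ B ∈ C := by
  refine hC.mem _ (hA.append hB) fun S hS => ⟨fun hc => ?_, fun hc => ?_⟩
  · rcases hc.split hA (hC.walk S hS) with hc | hc | ⟨A', B', rfl, h₁, h₂, h₃, h₄⟩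
    · exact (hA' S hS).1 hc
    · exact (hB' S hS).1 hc
    · exact (h A' B' ⟨h₁, h₂, hS⟩).1 ⟨(F.inRank_lt hA h₁).2 h₃, (F.outRank_lt h₂ hB).2 h₄⟩
  · rcases hc.split' hA (hC.walk S hS) with hc | hc | ⟨A', B', rfl, h₁, h₂, h₃, h₄⟩
    · exact (hA' S hS).2 hc
    · exact (hB' S hS).2 hc
    · exact (h A' B' ⟨h₁, h₂, hS⟩).2 ⟨(F.inRank_lt h₁ hA).2 h₃, (F.outRank_lt hB h₂).2 h₄⟩

/-- A path from the source that is coherent with all routes of a maximal clique extends to a route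
of the maximal clique. -/
theorem exists_extension (hC : F.IsMaxClique C) {v : Fin (n + 1)} {A : List E}
    (hA : G.IsWalk 0 A v) (h : ∀ S ∈ C, ¬ F.Cw A S ∧ ¬ F.Cw S A) :
    ∃ B, G.Through C v A B := by
  induction v using WellFoundedGT.induction generalizing A with
  | ind v ih =>
  by_cases hT : ∃ A₀ B₀, G.Through C v A₀ B₀
  · suffices ∃ A₀ B₀, G.Through C v A₀ B₀ ∧ ∀ A' B', G.Through C v A' B' →
        ¬ (F.inRank A < F.inRank A' ∧ F.outRank B' < F.outRank B₀) ∧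
        ¬ (F.inRank A' < F.inRank A ∧ F.outRank B₀ < F.outRank B') by
      obtain ⟨A₀, B, h₀, h₁⟩ := this
      exact ⟨B, hA, h₀.2.1, hC.append_mem hA h₀.2.1 h (hC.suffix_coherent h₀.2.2) h₁⟩
    -- The second half is borrowed from the largest route whose first half is at most `A`, or from
    -- the smallest route if there is none.
    by_cases hle : ∃ A₀ B₀, G.Through C v A₀ B₀ ∧ F.inRank A₀ ≤ F.inRank A
    · obtain ⟨A₀, B₀, h₀, h₁, h₂⟩ :=
        F.exists_max_through C v (fun A₀ _ => F.inRank A₀ ≤ F.inRank A) hle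
      refine ⟨A₀, B₀, h₀, fun A' B' h' => ?_⟩
      have := hC.chain h₀ h'
      have := hC.chain h' h₀
      have := h₂ A' B' h'
      omega
    · push Not at hle
      obtain ⟨A₀, B₀, h₀, -, h₂⟩ := F.exists_min_through C v (fun _ _ => True) (by simpa using hT)
      refine ⟨A₀, B₀, h₀, fun A' B' h' => ?_⟩
      have := hC.chain h₀ h'
      have := hC.chain h' h₀
      have := h₂ A' B' h' trivial
      have := hle A' B' h'
      omega
  -- No route of `C` meets `v`, so prolonging by any edge leaving `v` creates no conflict.
  · rcases eq_or_ne v (Fin.last n) with rfl | hv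
    · exact ⟨[], hA, rfl, by simpa using hC.mem A hA h⟩
    · obtain ⟨e, rfl⟩ : ∃ e, G.src e = v := by
        by_contra! h'
        exact hv (G.unique_sink v h')
      have hA' : G.IsWalk 0 (A ++ [e]) (G.tgt e) := isWalk_concat.2 ⟨hA, rfl⟩
      obtain ⟨B, hB⟩ := ih (G.tgt e) (G.src_lt_tgt e) hA' fun S hS => by
        have hw : G.IsWalk (G.src e) [e] (G.tgt e) := ⟨rfl, rfl⟩
        refine ⟨fun hc => ?_, fun hc => ?_⟩
        · rcases hc.split hA (hC.walk S hS) with hc | hc | ⟨A', B', rfl, h₁, h₂, -⟩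
          · exact (h S hS).1 hc
          · obtain ⟨X, -, M, Y, -, a, -, b, -, h₀, -⟩ := hc
            have := congrArg List.length h₀
            simp only [List.length_append, List.length_cons, List.length_nil] at this
            omega
          · exact hT ⟨A', B', h₁, h₂, hS⟩
        · rcases hc.split' hA (hC.walk S hS) with hc | hc | ⟨A', B', rfl, h₁, h₂, -⟩
          · exact (h S hS).2 hc
          · obtain ⟨-, X, M, -, Y, -, a, -, b, -, h₀, -⟩ := hc
            have := congrArg List.length h₀
            simp only [List.length_append, List.length_cons, List.length_nil] at this
            omega
          · exact hT ⟨A', B', h₁, h₂, hS⟩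
      exact ⟨e :: B, hA, ⟨rfl, hB.2.1⟩, by simpa using hB.2.2⟩

end IsMaxClique
end Framing
end FlowGraph

/-! ### Covering of edges, consecutive routes, and the relation of being cw from -/

namespace FlowGraph

variable {n : ℕ} {E : Type*} {G : FlowGraph n E}

namespace Framing

variable {F : G.Framing}

theorem not_cw_nil (l : List E) : ¬ F.Cw [] l ∧ ¬ F.Cw l [] := by
  refine ⟨?_, ?_⟩
  · rintro ⟨X, -, M, Y, -, e, -, g, -, h, -⟩
    simp at h
  · rintro ⟨-, X, M, -, Y, -, e, -, g, -, h, -⟩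
    simp at h

theorem not_cw_singleton (e : E) (l : List E) : ¬ F.Cw [e] l ∧ ¬ F.Cw l [e] := by
  refine ⟨?_, ?_⟩
  · rintro ⟨X, -, M, Y, -, e, -, g, -, h, -⟩
    have := congrArg List.length h
    simp only [List.length_append, List.length_cons, List.length_nil] at this
    omega
  · rintro ⟨-, X, M, -, Y, -, e, -, g, -, h, -⟩
    have := congrArg List.length h
    simp only [List.length_append, List.length_cons, List.length_nil] at this
    omega

theorem _root_.FlowGraph.IsWalk.exists_cons {B : List E} {v w : Fin (n + 1)}
    (h : G.IsWalk v B w) (hv : v ≠ w) : ∃ g Y, B = g :: Y ∧ G.src g = v := by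
  cases B with
  | nil => exact absurd h hv
  | cons g Y => exact ⟨g, Y, rfl, h.1⟩

variable [Finite E]

namespace IsMaxClique

variable {C D : Set (List E)}

/-- The selection is as in `exists_extension`, but the second halves are compared with `e` only
through their first edges: a first half is taken from the largest route leaving by an edge at most
`e`, or from the smallest route. Prolonged by `e` it is coherent with `C`, hence extends. -/
theorem exists_through_concat (hC : F.IsMaxClique C) (e : E)
    (h : ∃ A B, G.Through C (G.src e) A B) : ∃ A B, G.Through C (G.tgt e) (A ++ [e]) B := by
  have hne : G.src e ≠ Fin.last n := ((G.src_lt_tgt e).trans_le (Fin.le_last _)).ne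
  suffices ∃ A B, G.Through C (G.src e) A B ∧ ∀ A' g Y', G.Through C (G.src e) A' (g :: Y') →
      ¬ (F.inRank A < F.inRank A' ∧ F.edgeRank g < F.edgeRank e) ∧
      ¬ (F.inRank A' < F.inRank A ∧ F.edgeRank e < F.edgeRank g) by
    obtain ⟨A, B, hAB, hA⟩ := this
    have hw : G.IsWalk 0 (A ++ [e]) (G.tgt e) := isWalk_concat.2 ⟨hAB.1, rfl⟩
    obtain ⟨B', hB'⟩ := hC.exists_extension hw fun S hS => by
      refine ⟨fun hc => ?_, fun hc => ?_⟩
      · rcases hc.split hAB.1 (hC.walk S hS) with hc | hc | ⟨A', B', rfl, h₁, h₂, h₃, h₄⟩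
        · exact (hC.prefix_coherent hAB.2.2 S hS).1 hc
        · exact (not_cw_singleton e S).1 hc
        · obtain ⟨M, Y', Y, g, f, rfl, h₅, h₆⟩ := h₄
          obtain ⟨rfl, rfl⟩ : M = [] ∧ e = f := by cases M <;> simp_all
          exact (hA A' g Y' ⟨h₁, h₂, hS⟩).1 ⟨F.inRank_lt_of hAB.1 h₃, F.edgeRank_lt_of h₆⟩
      · rcases hc.split' hAB.1 (hC.walk S hS) with hc | hc | ⟨A', B', rfl, h₁, h₂, h₃, h₄⟩
        · exact (hC.prefix_coherent hAB.2.2 S hS).2 hc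
        · exact (not_cw_singleton e S).2 hc
        · obtain ⟨M, Y, Y', f, g, h₅, rfl, h₆⟩ := h₄
          obtain ⟨rfl, rfl⟩ : M = [] ∧ e = f := by cases M <;> simp_all
          exact (hA A' g Y' ⟨h₁, h₂, hS⟩).2 ⟨F.inRank_lt_of h₁ h₃, F.edgeRank_lt_of h₆⟩
    exact ⟨A, B', hB'⟩
  by_cases hle : ∃ A B, G.Through C (G.src e) A B ∧
      ∃ g Y, B = g :: Y ∧ F.edgeRank g ≤ F.edgeRank e
  · obtain ⟨A, B, h₀, ⟨g, Y, rfl, h₁⟩, h₂⟩ := F.exists_max_through C (G.src e)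
      (fun _ B => ∃ g Y, B = g :: Y ∧ F.edgeRank g ≤ F.edgeRank e) hle
    refine ⟨A, _, h₀, fun A' g' Y' h' => ?_⟩
    have := hC.chain h₀ h'
    have := hC.chain h' h₀
    have h₃ := h₂ A' _ h'
    have := F.edgeRank_le h'.2.1 h₀.2.1
    refine ⟨fun h₄ => ?_, fun h₄ => ?_⟩
    · have := h₃ ⟨g', Y', rfl, h₄.2.le⟩
      omega
    · omega
  · push Not at hle
    obtain ⟨A, B, h₀, -, h₂⟩ :=
      F.exists_min_through C (G.src e) (fun _ _ => True) (by simpa using h)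
    refine ⟨A, B, h₀, fun A' g Y' h' => ?_⟩
    have := hC.chain h₀ h'
    have := hC.chain h' h₀
    have := h₂ A' _ h' trivial
    have := hle A' _ h' g Y' rfl
    omega

/-- Every vertex is on a route of a maximal clique. -/
theorem exists_through (hC : F.IsMaxClique C) (v : Fin (n + 1)) : ∃ A B, G.Through C v A B := by
  induction v using WellFoundedLT.induction with
  | ind v ih =>
  rcases eq_or_ne v 0 with rfl | hv
  · exact ⟨[], hC.exists_extension rfl fun S _ => not_cw_nil S⟩
  · obtain ⟨e, rfl⟩ : ∃ e, G.tgt e = v := by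
      by_contra! h'
      exact hv (G.unique_source v h')
    obtain ⟨A, B, h⟩ := hC.exists_through_concat e (ih _ (G.src_lt_tgt e))
    exact ⟨_, _, h⟩

/-- Every edge is on a route of a maximal clique. -/
theorem exists_through_edge (hC : F.IsMaxClique C) (e : E) :
    ∃ A B, G.Through C (G.tgt e) (A ++ [e]) B :=
  hC.exists_through_concat e (hC.exists_through _)

theorem exists_through_edge' (hC : F.IsMaxClique C) (e : E) :
    ∃ A B, G.Through C (G.src e) A (e :: B) := by
  obtain ⟨A, B, h₁, h₂, h₃⟩ := hC.exists_through_edge e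
  exact ⟨A, B, (isWalk_concat.1 h₁).1, ⟨rfl, h₂⟩, by simpa using h₃⟩

/-- Consecutive routes at a vertex differ only before or only after this vertex. -/
theorem step (hC : F.IsMaxClique C) {v : Fin (n + 1)} {A B A' B' : List E}
    (h : G.Through C v A B) (h' : G.Through C v A' B')
    (hlt : F.inRank A + F.outRank B < F.inRank A' + F.outRank B')
    (hno : ∀ X Y, G.Through C v X Y → F.inRank X + F.outRank Y ≤ F.inRank A + F.outRank B ∨
      F.inRank A' + F.outRank B' ≤ F.inRank X + F.outRank Y) : A = A' ∨ B = B' := by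
  by_contra! hne
  have h₁ : F.inRank A ≠ F.inRank A' := fun h₀ => hne.1 (F.inRank_inj h.1 h'.1 h₀)
  have h₂ : F.outRank B ≠ F.outRank B' := fun h₀ => hne.2 (F.outRank_inj h.2.1 h'.2.1 h₀)
  have h₃ := hC.chain h h'
  have h₄ := hC.chain h' h
  -- If both coordinates change, the mixed route is coherent with the whole chain and lies strictly
  -- between the two consecutive routes.
  have h₅ : A ++ B' ∈ C := hC.append_mem h.1 h'.2.1 (hC.prefix_coherent h.2.2)
    (hC.suffix_coherent h'.2.2) fun X Y hXY => by
      have := hC.chain h hXY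
      have := hC.chain hXY h
      have := hC.chain h' hXY
      have := hC.chain hXY h'
      have := hno X Y hXY
      omega
  have := hno A B' ⟨h.1, h'.2.1, h₅⟩
  omega

end IsMaxClique

/-- Suppose `l''` in `C'` is cw from `l` in `C`, and cut at the first vertex of their common
segment. A route of `D` with first half below that of `l` has second half at most that of `l`; one
with first half above that of `l''` has second half at least that of `l''`. These two kinds exhaust
the chain of `D`, exclude each other, and both occur because `D` uses both entering edges. Where the
chain passes from one kind to the other, both halves change, contrary to `step`. -/
theorem CwFrom.trans {C D C' : Set (List E)} (hC : F.IsMaxClique C) (hD : F.IsMaxClique D)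
    (hC' : F.IsMaxClique C') (h : F.CwFrom C D) (h' : F.CwFrom D C') : F.CwFrom C C' := by
  rintro l hl l'' hl'' ⟨X'', X, M, Y'', Y, e'', e, g'', g, rfl, rfl, h₁, h₂⟩
  have e₁ : X ++ e :: (M ++ g :: Y) = (X ++ [e]) ++ (M ++ g :: Y) := by simp
  have e₂ : X'' ++ e'' :: (M ++ g'' :: Y'') = (X'' ++ [e'']) ++ (M ++ g'' :: Y'') := by simp
  have w₁ := isWalk_append_cons.1 (hC.walk _ hl)
  have w₂ := isWalk_append_cons.1 (hC'.walk _ hl'')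
  obtain ⟨A₁, B₁, t₁⟩ := hD.exists_through_edge e
  obtain ⟨A₂, B₂, t₂⟩ := hD.exists_through_edge e''
  have u₁ : G.IsWalk 0 (X ++ [e]) (G.tgt e) := isWalk_concat.2 ⟨w₁.1, rfl⟩
  have u₂ : G.IsWalk 0 (X'' ++ [e'']) (G.tgt e) := isWalk_concat.2 ⟨w₂.1, h₁.tgt_eq⟩
  have s₁ := w₁.2
  have s₂ := w₂.2
  rw [h₁.tgt_eq] at s₂ t₂
  rw [e₁] at hl
  rw [e₂] at hl''
  have r₁ : F.inRank (X'' ++ [e'']) < F.inRank (A₁ ++ [e]) :=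
    F.inRank_lt_of u₂ ⟨X'', A₁, [], e'', e, rfl, rfl, h₁⟩
  have r₂ : F.inRank (A₂ ++ [e'']) < F.inRank (X ++ [e]) :=
    F.inRank_lt_of t₂.1 ⟨A₂, X, [], e'', e, rfl, rfl, h₁⟩
  have r₃ : F.inRank (X'' ++ [e'']) < F.inRank (X ++ [e]) :=
    F.inRank_lt_of u₂ ⟨X'', X, [], e'', e, rfl, rfl, h₁⟩
  have r₄ : F.outRank (M ++ g :: Y) < F.outRank (M ++ g'' :: Y'') :=
    F.outRank_lt_of s₁ ⟨M, Y, Y'', g, g'', rfl, rfl, h₂⟩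
  obtain ⟨A₃, B₃, t₃, t₃', t₃''⟩ := F.exists_max_through D (G.tgt e)
    (fun A _ => F.inRank A < F.inRank (X ++ [e])) ⟨_, _, t₂, r₂⟩
  obtain ⟨A₄, B₄, t₄, t₄', t₄''⟩ := F.exists_min_through D (G.tgt e)
    (fun A _ => F.inRank (X'' ++ [e'']) < F.inRank A) ⟨_, _, t₁, r₁⟩
  have key : ∀ A B, G.Through D (G.tgt e) A B →
      ¬ (F.inRank A < F.inRank (X ++ [e]) ∧ F.outRank (M ++ g :: Y) < F.outRank B) ∧
      ¬ (F.inRank (X'' ++ [e'']) < F.inRank A ∧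
        F.outRank B < F.outRank (M ++ g'' :: Y'')) := fun A B hAB =>
    ⟨fun hh => h _ hl _ hAB.2.2 (cw_of_rank hAB.1 hAB.2.1 u₁ s₁ hh.1 hh.2),
      fun hh => h' _ hAB.2.2 _ hl'' (cw_of_rank u₂ s₂ hAB.1 hAB.2.1 hh.1 hh.2)⟩
  have k₃ := key _ _ t₃
  have k₄ := key _ _ t₄
  have hst := hD.step t₃ t₄ (by omega) fun A B hAB => by
    have := t₃'' A B hAB
    have := t₄'' A B hAB
    omega
  rcases hst with rfl | rfl <;> omega

/-- A clockwise relation between the exchanged routes of two adjacent maximal cliques excludes the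
opposite one, if it takes place at the first vertex at which the routes are incoherent. -/
theorem not_cw_of_first {C D : Set (List E)} (hC : F.IsMaxClique C) (hD : F.IsMaxClique D)
    {v : Fin (n + 1)} {A B A' B' : List E} (h : G.Through C v A B) (h' : G.Through D v A' B')
    (hCD : ∀ S, S ∈ C ∧ S ≠ A ++ B ↔ S ∈ D ∧ S ≠ A' ++ B')
    (hA : F.inRank A < F.inRank A') (hB : F.outRank B' < F.outRank B)
    (h₁ : ¬ F.Cw A (A' ++ B') ∧ ¬ F.Cw (A' ++ B') A) (h₂ : ¬ F.Cw A' (A ++ B)) :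
    ¬ F.Cw (A' ++ B') (A ++ B) := by
  intro hc
  -- The mixed route lies in both cliques. Hence `B'` is coherent with `A ++ B`, which rules out the
  -- only remaining place for the opposite conflict.
  have hmem : A ++ B' ∈ D := by
    refine hD.append_mem h.1 h'.2.1 (fun S hS => ?_) (hD.suffix_coherent h'.2.2)
      fun X Y hXY => ?_
    · by_cases hS' : S = A' ++ B'
      · exact hS' ▸ h₁
      · exact hC.prefix_coherent h.2.2 S ((hCD S).2 ⟨hS, hS'⟩).1
    · have c₁ := hD.chain hXY h'
      have c₂ := hD.chain h' hXY
      by_cases hS' : X ++ Y = A' ++ B'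
      · obtain ⟨rfl, rfl⟩ := hXY.1.split_unique h'.1 hS'
        omega
      · have hXY' : G.Through C v X Y := ⟨hXY.1, hXY.2.1, ((hCD _).2 ⟨hXY.2.2, hS'⟩).1⟩
        have := hC.chain hXY' h
        have := hC.chain h hXY'
        omega
  have hmem' : A ++ B' ∈ C := ((hCD _).2 ⟨hmem, fun he => by
    obtain ⟨rfl, -⟩ := h.1.split_unique h'.1 he
    exact lt_irrefl _ hA⟩).1
  rcases hc.split h'.1 (hC.walk _ h.2.2) with hc | hc | ⟨X, Y, he, h₃, -, h₄, -⟩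
  · exact h₂ hc
  · exact hC.not_cw _ hmem' _ h.2.2 (hc.append_left A)
  · obtain ⟨rfl, rfl⟩ := h.1.split_unique h₃ he
    have := F.inRank_lt_of h'.1 h₄
    omega

/-- Any pair other than `R`, `R'` lies in a common clique. For this pair, `not_cw_of_first` applies
at the first vertex of incoherence, in whichever direction it holds there; if it is the opposite
direction, the two cliques change roles. -/
theorem cwFrom_of_exchange {C D : Set (List E)} (hC : F.IsMaxClique C) (hD : F.IsMaxClique D)
    {R R' : List E} (hR : R ∈ C) (hR' : R' ∈ D) (hCD : ∀ S, S ∈ C ∧ S ≠ R ↔ S ∈ D ∧ S ≠ R')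
    (h : F.Cw R R') : F.CwFrom C D := by
  have main : ¬ F.Cw R' R := by
    intro hc
    let K : Fin (n + 1) → Prop := fun v => ∃ A B A' B', R = A ++ B ∧ R' = A' ++ B' ∧
      G.Through C v A B ∧ G.Through D v A' B' ∧
      (F.pathInLT A A' ∧ F.pathOutLT B' B ∨ F.pathInLT A' A ∧ F.pathOutLT B B')
    have hK : ∃ v, K v := by
      obtain ⟨v, -, -, A, B, A', B', rfl, rfl, h₁, h₂, h₃, h₄, h₅, h₆⟩ :=
        h.exists_vertex (hC.walk _ hR) (hD.walk _ hR')
      exact ⟨v, A, B, A', B', rfl, rfl, ⟨h₁, h₂, hR⟩, ⟨h₃, h₄, hR'⟩, .inl ⟨h₅, h₆⟩⟩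
    obtain ⟨v, ⟨A, B, A', B', rfl, rfl, h₁, h₂, h₃⟩, hmin⟩ := WellFounded.has_min
      (wellFounded_lt (α := Fin (n + 1))) {v | K v} hK
    -- A conflict involving only an initial part up to `v` would take place at a smaller vertex.
    have k₁ : ¬ F.Cw A (A' ++ B') := fun hc => by
      obtain ⟨w, hw, -, Z, Z₁, Z', Z₂, rfl, he, z₁, z₂, z₃, z₄, z₅, z₆⟩ :=
        hc.exists_vertex h₁.1 (hD.walk _ hR')
      obtain ⟨M, T, T', f, g, rfl, rfl, z₇⟩ := z₆
      exact hmin w ⟨Z, _, Z', _, List.append_assoc _ _ _, he,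
        ⟨z₁, z₂.append h₁.2.1, by simpa using hR⟩, ⟨z₃, z₄, he ▸ hR'⟩,
        .inl ⟨z₅, M, T, T' ++ B, f, g, rfl, by simp, z₇⟩⟩ hw
    have k₂ : ¬ F.Cw (A' ++ B') A := fun hc => by
      obtain ⟨w, -, hw, Z', Z₂, Z, Z₁, he, rfl, z₃, z₄, z₁, z₂, z₅, z₆⟩ :=
        hc.exists_vertex (hD.walk _ hR') h₁.1
      obtain ⟨M, T', T, g, f, rfl, rfl, z₇⟩ := z₆
      exact hmin w ⟨Z, _, Z', _, List.append_assoc _ _ _, he,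
        ⟨z₁, z₂.append h₁.2.1, by simpa using hR⟩, ⟨z₃, z₄, he ▸ hR'⟩,
        .inr ⟨z₅, M, T' ++ B, T, g, f, by simp, rfl, z₇⟩⟩ hw
    have k₃ : ¬ F.Cw A' (A ++ B) := fun hc => by
      obtain ⟨w, hw, -, Z', Z₂, Z, Z₁, rfl, he, z₃, z₄, z₁, z₂, z₅, z₆⟩ :=
        hc.exists_vertex h₂.1 (hC.walk _ hR)
      obtain ⟨M, T, T', g, f, rfl, rfl, z₇⟩ := z₆
      exact hmin w ⟨Z, _, Z', _, he, List.append_assoc _ _ _, ⟨z₁, z₂, he ▸ hR⟩,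
        ⟨z₃, z₄.append h₂.2.1, by simpa using hR'⟩,
        .inr ⟨z₅, M, T, T' ++ B', g, f, rfl, by simp, z₇⟩⟩ hw
    have k₄ : ¬ F.Cw (A ++ B) A' := fun hc => by
      obtain ⟨w, -, hw, Z, Z₁, Z', Z₂, he, rfl, z₁, z₂, z₃, z₄, z₅, z₆⟩ :=
        hc.exists_vertex (hC.walk _ hR) h₂.1
      obtain ⟨M, T', T, f, g, rfl, rfl, z₇⟩ := z₆
      exact hmin w ⟨Z, _, Z', _, he, List.append_assoc _ _ _, ⟨z₁, z₂, he ▸ hR⟩,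
        ⟨z₃, z₄.append h₂.2.1, by simpa using hR'⟩,
        .inl ⟨z₅, M, T' ++ B', T, f, g, by simp, rfl, z₇⟩⟩ hw
    rcases h₃ with h₃ | h₃
    · exact not_cw_of_first hC hD h₁ h₂ hCD (F.inRank_lt_of h₁.1 h₃.1)
        (F.outRank_lt_of h₂.2.1 h₃.2) ⟨k₁, k₂⟩ k₃ hc
    · exact not_cw_of_first hD hC h₂ h₁ (fun S => (hCD S).symm) (F.inRank_lt_of h₂.1 h₃.1)
        (F.outRank_lt_of h₁.2.1 h₃.2) ⟨k₃, k₄⟩ k₁ h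
  intro S hS S' hS' hc
  by_cases h₁ : S = R
  · by_cases h₂ : S' = R'
    · exact main (h₁ ▸ h₂ ▸ hc)
    · exact hC.not_cw _ ((hCD S').2 ⟨hS', h₂⟩).1 _ hS hc
  · exact hD.not_cw _ hS' _ ((hCD S).1 ⟨hS, h₁⟩).1 hc

end Framing
end FlowGraph

/-! ### Rotations at a corner -/

namespace FlowGraph

variable {n : ℕ} {E : Type*} {G : FlowGraph n E}

namespace Framing

variable {F : G.Framing}

/-- The routes of `C` at `v` that make a rotation possible: `a ++ b`, `a ++ c` and `d ++ c` are
consecutive routes of `C` at `v`. -/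
structure IsCorner (F : G.Framing) (C : Set (List E)) (v : Fin (n + 1)) (a d b c : List E) :
    Prop where
  left : G.Through C v a b
  mid : G.Through C v a c
  right : G.Through C v d c
  in_lt : F.inRank a < F.inRank d
  out_lt : F.outRank b < F.outRank c
  consecutive : ∀ x y, G.Through C v x y → F.inRank x ≤ F.inRank a ∧ F.outRank y ≤ F.outRank b ∨
    x = a ∧ y = c ∨ F.inRank d ≤ F.inRank x ∧ F.outRank c ≤ F.outRank y

namespace IsCorner

variable {C : Set (List E)} {v : Fin (n + 1)} {a b c d : List E}

variable [Finite E] in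
theorem cw (h : IsCorner F C v a d b c) : F.Cw (a ++ c) (d ++ b) :=
  cw_of_rank h.mid.1 h.mid.2.1 h.right.1 h.left.2.1 h.in_lt h.out_lt

theorem left_ne (h : IsCorner F C v a d b c) : a ++ b ≠ a ++ c := fun he => by
  obtain rfl := List.append_cancel_left he
  exact lt_irrefl _ h.out_lt

theorem right_ne (h : IsCorner F C v a d b c) : d ++ c ≠ a ++ c := fun he => by
  obtain rfl := List.append_cancel_right he
  exact lt_irrefl _ h.in_lt

variable [Finite E]

theorem coherent (h : IsCorner F C v a d b c) (hC : F.IsMaxClique C) {S : List E} (hS : S ∈ C)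
    (hne : S ≠ a ++ c) : ¬ F.Cw S (d ++ b) ∧ ¬ F.Cw (d ++ b) S := by
  refine ⟨fun hc => ?_, fun hc => ?_⟩
  · rcases hc.split' h.right.1 (hC.walk S hS) with hc | hc | ⟨x, y, rfl, h₁, h₂, h₃, h₄⟩
    · exact (hC.prefix_coherent h.right.2.2 S hS).2 hc
    · exact (hC.suffix_coherent h.left.2.2 S hS).2 hc
    · have h₃ := F.inRank_lt_of h₁ h₃
      have h₄ := F.outRank_lt_of h.left.2.1 h₄
      rcases h.consecutive x y ⟨h₁, h₂, hS⟩ with h₅ | ⟨rfl, rfl⟩ | h₅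
      · omega
      · exact hne rfl
      · omega
  · rcases hc.split h.right.1 (hC.walk S hS) with hc | hc | ⟨x, y, rfl, h₁, h₂, h₃, h₄⟩
    · exact (hC.prefix_coherent h.right.2.2 S hS).1 hc
    · exact (hC.suffix_coherent h.left.2.2 S hS).1 hc
    · have h₃ := F.inRank_lt_of h.right.1 h₃
      have h₄ := F.outRank_lt_of h₂ h₄
      have := h.in_lt
      have := h.out_lt
      rcases h.consecutive x y ⟨h₁, h₂, hS⟩ with h₅ | ⟨rfl, rfl⟩ | h₅ <;> omega

/-- A rotation of a maximal clique. -/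
theorem isMaxClique (h : IsCorner F C v a d b c) (hC : F.IsMaxClique C) :
    F.IsMaxClique (C \ {a ++ c} ∪ {d ++ b}) := by
  have hw : G.IsWalk 0 (d ++ b) (Fin.last n) := h.right.1.append h.left.2.1
  have hab : a ++ b ∈ C \ {a ++ c} ∪ {d ++ b} := .inl ⟨h.left.2.2, h.left_ne⟩
  have hdc : d ++ c ∈ C \ {a ++ c} ∪ {d ++ b} := .inl ⟨h.right.2.2, h.right_ne⟩
  refine ⟨?_, ?_, ?_⟩
  · rintro l (⟨hl, -⟩ | rfl)
    · exact hC.walk l hl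
    · exact hw
  · rintro l (⟨hl, hne⟩ | rfl) l' (⟨hl', hne'⟩ | rfl)
    · exact hC.not_cw l hl l' hl'
    · exact (h.coherent hC hl hne).1
    · exact (h.coherent hC hl' hne').2
    · exact not_cw_self hw
  · intro T hT hcoh
    by_contra hmem
    have hTR' : T ≠ d ++ b := fun he => hmem (.inr he)
    have hTC : ∀ S ∈ C, S ≠ a ++ c → ¬ F.Cw T S ∧ ¬ F.Cw S T :=
      fun S hS hne => hcoh S (.inl ⟨hS, hne⟩)
    -- A route that could be added after the rotation must conflict with the removed route. The
    -- halves `a` and `c` survive in `a ++ b` and `d ++ c`, so the conflict is at `v`.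
    have hTR : F.Cw T (a ++ c) ∨ F.Cw (a ++ c) T := by
      by_contra! hc
      have hTC' : T ∈ C := hC.mem T hT fun S hS => by
        by_cases hS' : S = a ++ c
        · exact hS' ▸ hc
        · exact hTC S hS hS'
      by_cases hT' : T = a ++ c
      · exact (hcoh _ (.inr rfl)).1 (hT' ▸ h.cw)
      · exact hmem (.inl ⟨hTC', hT'⟩)
    have hpre : ¬ F.Cw T a ∧ ¬ F.Cw a T :=
      ⟨fun hc => (hcoh _ hab).1 (hc.append_right' b), fun hc => (hcoh _ hab).2 (hc.append_right b)⟩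
    have hsuf : ¬ F.Cw T c ∧ ¬ F.Cw c T :=
      ⟨fun hc => (hcoh _ hdc).1 (hc.append_left' d), fun hc => (hcoh _ hdc).2 (hc.append_left d)⟩
    have hloc : ∃ x y, T = x ++ y ∧ G.IsWalk 0 x v ∧ G.IsWalk v y (Fin.last n) ∧
        (F.inRank x < F.inRank a ∧ F.outRank c < F.outRank y ∨
          F.inRank a < F.inRank x ∧ F.outRank y < F.outRank c) := by
      rcases hTR with hc | hc
      · rcases hc.split' h.mid.1 hT with hc | hc | ⟨x, y, rfl, h₁, h₂, h₃, h₄⟩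
        · exact (hpre.1 hc).elim
        · exact (hsuf.1 hc).elim
        · exact ⟨x, y, rfl, h₁, h₂, .inl ⟨F.inRank_lt_of h₁ h₃, F.outRank_lt_of h.mid.2.1 h₄⟩⟩
      · rcases hc.split h.mid.1 hT with hc | hc | ⟨x, y, rfl, h₁, h₂, h₃, h₄⟩
        · exact (hpre.2 hc).elim
        · exact (hsuf.2 hc).elim
        · exact ⟨x, y, rfl, h₁, h₂, .inr ⟨F.inRank_lt_of h.mid.1 h₃, F.outRank_lt_of h₂ h₄⟩⟩
    obtain ⟨x, y, rfl, hx, hy, hxy⟩ := hloc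
    have cross : ∀ p q, G.IsWalk 0 p v → G.IsWalk v q (Fin.last n) →
        p ++ q ∈ C \ {a ++ c} ∪ {d ++ b} →
        ¬ (F.inRank x < F.inRank p ∧ F.outRank q < F.outRank y) ∧
        ¬ (F.inRank p < F.inRank x ∧ F.outRank y < F.outRank q) := fun p q hp hq hpq =>
      ⟨fun hh => (hcoh _ hpq).1 (cw_of_rank hx hy hp hq hh.1 hh.2),
        fun hh => (hcoh _ hpq).2 (cw_of_rank hp hq hx hy hh.1 hh.2)⟩
    have k₁ := cross a b h.left.1 h.left.2.1 hab
    have k₂ := cross d c h.right.1 h.right.2.1 hdc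
    have k₃ := cross d b h.right.1 h.left.2.1 (.inr rfl)
    have hlt := h.in_lt
    have hlt' := h.out_lt
    have hxR : ¬ F.Cw x (a ++ c) ∧ ¬ F.Cw (a ++ c) x := by
      refine ⟨fun hc => ?_, fun hc => ?_⟩
      · rcases hc.split' h.mid.1 hx with hc | hc | ⟨x', y', rfl, h₁, h₂, -, h₄⟩
        · exact hpre.1 (hc.append_right y)
        · exact hsuf.1 (hc.append_right y)
        · obtain rfl := h₂.eq_nil
          obtain ⟨M, Y, Y', e, f, -, h₅, -⟩ := h₄
          simp at h₅
      · rcases hc.split h.mid.1 hx with hc | hc | ⟨x', y', rfl, h₁, h₂, -, h₄⟩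
        · exact hpre.2 (hc.append_right' y)
        · exact hsuf.2 (hc.append_right' y)
        · obtain rfl := h₂.eq_nil
          obtain ⟨M, Y, Y', e, f, h₅, -, -⟩ := h₄
          simp at h₅
    have hyR : ¬ F.Cw y (a ++ c) ∧ ¬ F.Cw (a ++ c) y := by
      refine ⟨fun hc => ?_, fun hc => ?_⟩
      · rcases hc.split' h.mid.1 hy with hc | hc | ⟨x', y', rfl, h₁, h₂, h₃, -⟩
        · exact hpre.1 (hc.append_left x)
        · exact hsuf.1 (hc.append_left x)
        · obtain rfl := h₁.eq_nil
          obtain ⟨Y, Y', M, e, f, h₅, -, -⟩ := h₃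
          simp at h₅
      · rcases hc.split h.mid.1 hy with hc | hc | ⟨x', y', rfl, h₁, h₂, h₃, -⟩
        · exact hpre.2 (hc.append_left' x)
        · exact hsuf.2 (hc.append_left' x)
        · obtain rfl := h₁.eq_nil
          obtain ⟨Y, Y', M, e, f, -, h₅, -⟩ := h₃
          simp at h₅
    -- Coherence with the three routes at the corner leaves `x = d` with `y` strictly between `b`
    -- and `c`, or `y = b` with `x` strictly between `a` and `d`. Then `a ++ y` or `x ++ c` lies in
    -- `C`, between consecutive routes.
    by_cases hxd : x = d
    · subst hxd
      have hyb : F.outRank y ≠ F.outRank b := fun he =>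
        hTR' (by rw [F.outRank_inj hy h.left.2.1 he])
      have hay : a ++ y ∈ C := by
        refine hC.append_mem h.mid.1 hy (hC.prefix_coherent h.mid.2.2) (fun S hS => ?_)
          fun p q hpq => ?_
        · by_cases hS' : S = a ++ c
          · exact hS' ▸ hyR
          · exact ⟨fun hc => (hTC S hS hS').1 (hc.append_left x),
              fun hc => (hTC S hS hS').2 (hc.append_left' x)⟩
        · rcases h.consecutive p q hpq with h₅ | ⟨rfl, rfl⟩ | h₅ <;> omega
      rcases h.consecutive a y ⟨h.mid.1, hy, hay⟩ with h₅ | ⟨-, rfl⟩ | h₅ <;> omega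
    · have hxd' : F.inRank x ≠ F.inRank d := fun he => hxd (F.inRank_inj hx h.right.1 he)
      have hxc : x ++ c ∈ C := by
        refine hC.append_mem hx h.mid.2.1 (fun S hS => ?_) (hC.suffix_coherent h.mid.2.2)
          fun p q hpq => ?_
        · by_cases hS' : S = a ++ c
          · exact hS' ▸ hxR
          · exact ⟨fun hc => (hTC S hS hS').1 (hc.append_right y),
              fun hc => (hTC S hS hS').2 (hc.append_right' y)⟩
        · rcases h.consecutive p q hpq with h₅ | ⟨rfl, rfl⟩ | h₅ <;> omega
      rcases h.consecutive x c ⟨hx, h.mid.2.1, hxc⟩ with h₅ | ⟨rfl, -⟩ | h₅ <;> omega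

end IsCorner

/-! ### Finding a rotation towards a given maximal clique -/

variable [Finite E]

/-- The position at which a maximal clique can be rotated towards a maximal clique that it is cw
from. -/
theorem exists_corner {C D : Set (List E)} (hC : F.IsMaxClique C) (hD : F.IsMaxClique D)
    (hCD : F.CwFrom C D) (hne : C ≠ D) : ∃ v a d b c, IsCorner F C v a d b c ∧
      F.CwFrom (C \ {a ++ c} ∪ {d ++ b}) D := by
  -- These are the vertices at which the common segment of a conflict ends.
  let K : Fin (n + 1) → Prop := fun v => ∃ A A' g k Y Y', G.Through C v A (g :: Y) ∧
    G.Through D v A' (k :: Y') ∧ F.inRank A < F.inRank A' ∧ F.outLT k g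
  have hK' : ∀ {l l'}, l ∈ C → l' ∈ D → ∀ {X X' M Y Y' e f g k}, l = X ++ e :: (M ++ g :: Y) →
      l' = X' ++ f :: (M ++ k :: Y') → F.inLT e f → F.outLT k g → K (G.src g) := by
    rintro _ _ hl hl' X X' M Y Y' e f g k rfl rfl h₁ h₂
    have e₁ : X ++ e :: (M ++ g :: Y) = (X ++ e :: M) ++ g :: Y := by simp
    have e₂ : X' ++ f :: (M ++ k :: Y') = (X' ++ f :: M) ++ k :: Y' := by simp
    rw [e₁] at hl
    rw [e₂] at hl'
    have w₁ := isWalk_append_cons.1 (hC.walk _ hl)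
    have w₂ := isWalk_append_cons.1 (hD.walk _ hl')
    refine ⟨_, _, g, k, Y, Y', ⟨w₁.1, ⟨rfl, w₁.2⟩, hl⟩, ⟨h₂.src_eq ▸ w₂.1, ⟨h₂.src_eq, w₂.2⟩, hl'⟩,
      F.inRank_lt_of w₁.1 ⟨X, X', M, e, f, rfl, rfl, h₁⟩, h₂⟩
  have hK : ∃ v, K v := by
    obtain ⟨l, hl, l', hl', X, X', M, Y, Y', e, f, g, k, h₀, h₁, h₂, h₃⟩ :
        ∃ l ∈ C, ∃ l' ∈ D, F.Cw l l' := by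
      by_contra! hcw
      exact hne (Set.Subset.antisymm
        (fun l hl => hD.mem l (hC.walk l hl) fun l' hl' => ⟨hcw l hl l' hl', hCD l hl l' hl'⟩)
        (fun l hl => hC.mem l (hD.walk l hl) fun l' hl' => ⟨hCD l' hl' l hl, hcw l' hl' l hl⟩))
    exact ⟨_, hK' hl hl' h₀ h₁ h₂ h₃⟩
  obtain ⟨v, hKv, hmin⟩ := WellFounded.has_min (wellFounded_lt (α := Fin (n + 1))) {v | K v} hK
  -- No conflict ends before the minimal vertex `v`, so initial parts up to `v` of routes of `D` are
  -- coherent with `C`.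
  have hpre : ∀ A B, G.Through D v A B → ∃ B', G.Through C v A B' := fun A B hAB => by
    refine hC.exists_extension hAB.1 fun S hS => ⟨fun hc => ?_, ?_⟩
    · exact hCD _ hS _ hAB.2.2 (hc.append_right B)
    · rintro ⟨X, X', M, Y, Y', e, f, g, k, rfl, rfl, h₁, h₂⟩
      refine hmin (G.src g) (hK' hS hAB.2.2 rfl (X' := X') (Y' := Y' ++ B) (by simp) h₁ h₂) ?_
      have e₁ : X' ++ f :: (M ++ k :: Y') = (X' ++ f :: M) ++ k :: Y' := by simp
      have hw := (isWalk_append_cons.1 (e₁ ▸ hAB.1)).2.le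
      exact h₂.src_eq ▸ (G.src_lt_tgt k).trans_le hw
  -- the smallest route `a ++ g :: Y` of `C` with a conflict at `v`
  obtain ⟨a, _, hP, ⟨g, Y, A', k, Y', rfl, hQ, haA', hkg⟩, hPmin⟩ := F.exists_min_through C v
    (fun A B => ∃ g Y A' k Y', B = g :: Y ∧ G.Through D v A' (k :: Y') ∧
      F.inRank A < F.inRank A' ∧ F.outLT k g) (by
        obtain ⟨A, A', g, k, Y, Y', h₁, h₂, h₃, h₄⟩ := hKv
        exact ⟨A, _, h₁, g, Y, A', k, Y', rfl, h₂, h₃, h₄⟩)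
  have hkg' := F.edgeRank_lt_of hkg
  have hvk : G.src k = v := hQ.2.1.1
  have hvlast : v ≠ Fin.last n := (hvk ▸ (G.src_lt_tgt k).trans_le (Fin.le_last _)).ne
  have head : ∀ {e f : E} {Z Z' : List E}, G.IsWalk v (e :: Z) (Fin.last n) →
      G.IsWalk v (f :: Z') (Fin.last n) → F.edgeRank e < F.edgeRank f →
      F.outRank (e :: Z) < F.outRank (f :: Z') := fun h₁ h₂ h₃ => by
    by_contra! h₄
    exact (F.edgeRank_le h₂ h₁ h₄).not_gt h₃
  -- its predecessor `a ++ b₁`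
  obtain ⟨a₁, b₁, hA₁, hA₁P, hA₁max⟩ := F.exists_max_through C v
    (fun A B => F.inRank A + F.outRank B < F.inRank a + F.outRank (g :: Y)) (by
      -- A route of `C` leaving `v` by `k` is smaller, so a predecessor exists.
      obtain ⟨A, B, hAB⟩ := hC.exists_through_edge' k
      rw [hvk] at hAB
      have := hC.chain hAB hP
      have := hC.chain hP hAB
      have := head hAB.2.1 hP.2.1 hkg'
      exact ⟨A, _, hAB, by omega⟩)
  have c₁ := hC.chain hP hA₁
  have c₂ := hC.chain hA₁ hP
  -- With a common second half instead, the predecessor would be a smaller route in conflict with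
  -- the same route of `D`.
  obtain rfl : a₁ = a := by
    rcases hC.step hA₁ hP hA₁P (fun A B hAB => by have := hA₁max A B hAB; omega) with h | rfl
    · exact h
    · have := hPmin a₁ _ hA₁ ⟨g, Y, A', k, Y', rfl, hQ, by omega, hkg⟩
      omega
  obtain ⟨g₁, Z₁, rfl, hg₁⟩ := hA₁.2.1.exists_cons hvlast
  have hg₁k : F.edgeRank g₁ ≤ F.edgeRank k := by
    by_contra! hlt
    have := hPmin a₁ _ hA₁
      ⟨g₁, Z₁, A', k, Y', rfl, hQ, haA', (F.edgeRank_lt (hvk.trans hg₁.symm)).1 hlt⟩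
    omega
  -- the last route `a ++ c` with the same first part, and its successor `d ++ c`
  obtain ⟨a₂, c, hR, rfl, hRmax⟩ := F.exists_max_through C v (fun A _ => A = a₁) ⟨_, _, hP, rfl⟩
  -- The first half `A'` also occurs in `C`, so some route of `C` has a first half larger than `a`.
  obtain ⟨B', hB'⟩ := hpre _ _ hQ
  obtain ⟨d, c', hB, hBd, hBmin⟩ := F.exists_min_through C v
    (fun A _ => F.inRank a₂ < F.inRank A) ⟨_, _, hB', haA'⟩
  have hgap : ∀ X Z, G.Through C v X Z →
      F.inRank X + F.outRank Z ≤ F.inRank a₂ + F.outRank c ∨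
      F.inRank d + F.outRank c' ≤ F.inRank X + F.outRank Z := fun X Z hXZ => by
    have := hC.chain hXZ hR
    have := hC.chain hR hXZ
    have := hBmin X Z hXZ
    by_cases hX : F.inRank X = F.inRank a₂
    · have := hRmax X Z hXZ (F.inRank_inj hXZ.1 hR.1 hX)
      omega
    · omega
  have c₃ := hC.chain hR hB
  obtain rfl : c = c' := by
    rcases hC.step hR hB (by omega) hgap with rfl | h
    · exact absurd hBd (lt_irrefl _)
    · exact h
  have hPR := hRmax _ _ hP rfl
  -- the predecessor `a ++ b` of `a ++ c`
  obtain ⟨a₃, b, hA, hAR, hAmax⟩ := F.exists_max_through C v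
    (fun A B => F.inRank A + F.outRank B < F.inRank a₂ + F.outRank c)
    ⟨_, _, hA₁, by omega⟩
  have hA₁A := hAmax _ _ hA₁ (by omega)
  obtain rfl : a₃ = a₂ := by
    refine F.inRank_inj hA.1 hR.1 ?_
    have := hC.chain hA hR
    have := hC.chain hR hA
    have := hC.chain hA hA₁
    have := hC.chain hA₁ hA
    omega
  have hcorner : IsCorner F C v a₃ d b c := by
    refine ⟨hA, hR, hB, hBd, by omega, fun X Z hXZ => ?_⟩
    have := hC.chain hXZ hA
    have := hC.chain hA hXZ
    have := hC.chain hXZ hR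
    have := hC.chain hR hXZ
    have := hC.chain hXZ hB
    have := hC.chain hB hXZ
    have := hgap X Z hXZ
    have := hAmax X Z hXZ
    by_cases hX : X = a₃ ∧ Z = c
    · exact .inr (.inl hX)
    · have : F.inRank X ≠ F.inRank a₃ ∨ F.outRank Z ≠ F.outRank c := by
        by_contra! h
        exact hX ⟨F.inRank_inj hXZ.1 hR.1 h.1, F.outRank_inj hXZ.2.1 hR.2.1 h.2⟩
      omega
  refine ⟨v, a₃, d, b, c, hcorner, ?_⟩
  rintro l (⟨hl, -⟩ | rfl) l' hl' hcw
  · exact hCD l hl l' hl' hcw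
  -- A conflict with `d` or `b` alone is a conflict with `d ++ c` or `a ++ b` in `C`; what remains
  -- is a conflict at `v`.
  rcases hcw.split' hB.1 (hD.walk l' hl') with hc | hc | ⟨q₁, q₂, rfl, h₁, h₂, h₃, h₄⟩
  · exact hCD _ hB.2.2 _ hl' (hc.append_right' c)
  · exact hCD _ hA.2.2 _ hl' (hc.append_left' a₃)
  have h₃ := F.inRank_lt_of h₁ h₃
  have h₄' := F.outRank_lt_of hA.2.1 h₄
  obtain rfl : q₁ = a₃ := by
    refine F.inRank_inj h₁ hR.1 ?_
    have : ¬ F.inRank q₁ < F.inRank a₃ := fun h₅ =>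
      hCD _ hA.2.2 _ hl' (cw_of_rank h₁ h₂ hA.1 hA.2.1 h₅ h₄')
    obtain ⟨B'', hB''⟩ := hpre _ _ ⟨h₁, h₂, hl'⟩
    rcases hcorner.consecutive _ _ hB'' with h₅ | ⟨rfl, -⟩ | h₅
    · omega
    · rfl
    · omega
  have hq₂Q : F.outRank q₂ ≤ F.outRank (k :: Y') := by
    have := hD.chain ⟨h₁, h₂, hl'⟩ hQ
    omega
  obtain ⟨g₂, Y₂, rfl, hg₂⟩ := h₂.exists_cons hvlast
  have hg₂k := F.edgeRank_le h₂ hQ.2.1 hq₂Q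
  have hq₂P := head h₂ hP.2.1 (by omega)
  -- Since `b` lies below `q₂`, which lies below `g :: Y`, the route with second half `b` is the
  -- predecessor found first.
  obtain rfl : b = g₁ :: Z₁ := by
    have := hA₁max _ _ hA
    exact F.outRank_inj hA.2.1 hA₁.2.1 (by omega)
  -- the place where this conflict ends
  obtain ⟨M, W₁, W₂, s₁, s₂, hM₁, hM₂, hs⟩ := h₄
  have wM : G.IsWalk v M (G.src s₁) := (isWalk_append_cons.1 (hM₁ ▸ hA.2.1)).1
  have t₁ : G.Through C (G.src s₁) (q₁ ++ M) (s₁ :: W₁) :=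
    ⟨h₁.append wM, (hM₁ ▸ hA.2.1 : G.IsWalk v (M ++ s₁ :: W₁) _).right wM, by
      rw [List.append_assoc, ← hM₁]; exact hA.2.2⟩
  have t₂ : G.Through D (G.src s₁) (q₁ ++ M) (s₂ :: W₂) :=
    ⟨h₁.append wM, (hM₂ ▸ h₂ : G.IsWalk v (M ++ s₂ :: W₂) _).right wM, by
      rw [List.append_assoc, ← hM₂]; exact hl'⟩
  obtain ⟨p, S, hpS⟩ := hC.exists_through_edge' s₂
  rw [← hs.src_eq] at hpS
  have hsS : F.outRank (s₁ :: W₁) < F.outRank (s₂ :: S) :=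
    F.outRank_lt_of t₁.2.1 ⟨[], W₁, S, s₁, s₂, rfl, rfl, hs⟩
  have hsW : F.outRank (s₁ :: W₁) < F.outRank (s₂ :: W₂) :=
    F.outRank_lt_of t₁.2.1 ⟨[], W₁, W₂, s₁, s₂, rfl, rfl, hs⟩
  have c₄ := hC.chain t₁ hpS
  have c₅ := hC.chain hpS t₁
  obtain ⟨N₁, N₂, hN, hNlt, hNmin⟩ := F.exists_min_through C (G.src s₁)
    (fun A B => F.inRank (q₁ ++ M) + F.outRank (s₁ :: W₁) < F.inRank A + F.outRank B)
    ⟨_, _, hpS, by omega⟩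
  -- The successor in `C` at the branching vertex keeps one half. If it keeps the first, it gives at
  -- `v` a route strictly between `a ++ b` and `a ++ g :: Y`; if it keeps the second, the route of
  -- `D` is cw from it.
  rcases hC.step t₁ hN hNlt (fun A B hAB => by have := hNmin A B hAB; omega) with rfl | rfl
  · have hout : F.pathOutLT (s₁ :: W₁) N₂ := (F.outRank_lt t₁.2.1 hN.2.1).1 (by omega)
    have hN' : G.Through C v q₁ (M ++ N₂) :=
      ⟨h₁, wM.append hN.2.1, by simpa using hN.2.2⟩
    have h₅ := F.outRank_lt_of (hM₁ ▸ hA.2.1) (F.pathOutLT_append_left M hout)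
    rw [← hM₁] at h₅
    have h₆ := hA₁max _ _ hN'
    obtain ⟨g₃, Y₃, h₇, hg₃⟩ := hN'.2.1.exists_cons hvlast
    have h₈ : F.edgeRank g₃ ≤ F.edgeRank k := by
      cases M with
      | nil =>
        obtain rfl : N₂ = g₃ :: Y₃ := h₇
        obtain ⟨rfl, -⟩ : g₂ = s₂ ∧ Y₂ = W₂ := by simpa using hM₂
        have := hNmin _ _ hpS (by omega)
        have := hC.chain hN hpS
        have := hC.chain hpS hN
        exact (F.edgeRank_le hN.2.1 hpS.2.1 (by omega)).trans hg₂k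
      | cons m M =>
        rw [List.cons_append, List.cons.injEq] at h₇ hM₁
        rw [← h₇.1, ← hM₁.1]
        exact hg₁k
    have := head (h₇ ▸ hN'.2.1) hP.2.1 (by omega)
    rw [← h₇] at this
    omega
  · exact hCD _ hN.2.2 _ t₂.2.2
      (cw_of_rank t₂.1 t₂.2.1 hN.1 hN.2.1 (by omega) hsW)

end Framing
end FlowGraph

/-! ### From edge lists to routes, and the conclusion -/

namespace FlowGraph

variable {n : ℕ} {E : Type*} {G : FlowGraph n E}

theorem Path.IsRoute.isWalk {P : G.Path} (hP : P.IsRoute) :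
    G.IsWalk 0 P.edges (Fin.last n) := by
  have := P.isWalk
  rwa [hP.1, hP.2] at this

theorem Path.IsRoute.ext {P Q : G.Path} (hP : P.IsRoute) (hQ : Q.IsRoute)
    (h : P.edges = Q.edges) : P = Q :=
  Path.ext (hP.1.trans hQ.1.symm) (hP.2.trans hQ.2.symm) h

theorem Path.SplitAt.unique {P : G.Path} {v : Fin (n + 1)} {A B A' B' : List E}
    (h : P.SplitAt v A B) (h' : P.SplitAt v A' B') : A = A' ∧ B = B' :=
  h.2.1.split_unique h'.2.1 (h.1.symm.trans h'.1)

namespace Framing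

variable {F : G.Framing}

theorem CwAt.cw {P Q : G.Path} {v : Fin (n + 1)} (h : F.CwAt v P Q) :
    F.Cw P.edges Q.edges := by
  obtain ⟨A, B, A', B', h₁, h₂, h₃, h₄⟩ := h
  rw [h₁.1, h₂.1]
  exact cw_append h₃ h₄

/-- Each half contains a branching edge, so `v` is neither end; the inner-vertex condition in
incoherence is automatic. -/
theorem CwAt.isInner {P Q : G.Path} {v : Fin (n + 1)} (h : F.CwAt v P Q) :
    P.IsInner v ∧ Q.IsInner v := by
  obtain ⟨A, B, A', B', h₁, h₂, ⟨X, X', M, e, f, rfl, rfl, -⟩, ⟨N, Y, Y', g, k, rfl, rfl, -⟩⟩ := h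
  exact ⟨⟨⟨_, _, h₁⟩, (h₁.2.1.lt (by simp)).ne', (h₁.2.2.lt (by simp)).ne⟩,
    ⟨_, _, h₂⟩, (h₂.2.1.lt (by simp)).ne', (h₂.2.2.lt (by simp)).ne⟩

theorem Cw.exists_cwAt {P Q : G.Path} (h : F.Cw P.edges Q.edges) : ∃ v, F.CwAt v P Q := by
  obtain ⟨v, -, -, A, B, A', B', h₁, h₂, h₃, h₄, h₅, h₆, h₇⟩ := h.exists_vertex P.isWalk Q.isWalk
  exact ⟨v, A, B, A', B', ⟨h₁, h₃, h₄⟩, ⟨h₂, h₅, h₆⟩, h₇⟩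

theorem CwAt.asymm {P Q : G.Path} {v : Fin (n + 1)} (h : F.CwAt v P Q) : ¬ F.CwAt v Q P := by
  rintro ⟨C, D, C', D', h₁, h₂, h₃, -⟩
  obtain ⟨A, B, A', B', h₄, h₅, h₆, -⟩ := h
  obtain ⟨rfl, rfl⟩ := h₄.unique h₂
  obtain ⟨rfl, rfl⟩ := h₅.unique h₁
  exact F.pathInLT_irrefl _ (F.pathInLT_trans h₃ h₆)

theorem coherent_iff {P Q : G.Path} :
    F.Coherent P Q ↔ ¬ F.Cw P.edges Q.edges ∧ ¬ F.Cw Q.edges P.edges := by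
  refine ⟨fun h => ⟨fun hc => ?_, fun hc => ?_⟩, fun h v hP hQ hc => ?_⟩
  · obtain ⟨v, hv⟩ := hc.exists_cwAt
    exact h v hv.isInner.1 hv.isInner.2 ⟨hv.isInner.1, hv.isInner.2, .inl hv⟩
  · obtain ⟨v, hv⟩ := hc.exists_cwAt
    exact h v hv.isInner.2 hv.isInner.1 ⟨hv.isInner.2, hv.isInner.1, .inr hv⟩
  · rcases hc.2.2 with hc | hc
    · exact h.1 hc.cw
    · exact h.2 hc.cw

/-- At a fixed vertex the two cw relations exclude each other, so the alternative in `IsCwFrom` only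
forbids the reverse relation. -/
theorem isCwFrom_iff {C D : Set G.Path} :
    F.IsCwFrom C D ↔ F.CwFrom (Path.edges '' C) (Path.edges '' D) := by
  constructor
  · rintro h _ ⟨P, hP, rfl⟩ _ ⟨Q, hQ, rfl⟩ hc
    obtain ⟨v, hv⟩ := hc.exists_cwAt
    rcases h P hP Q hQ v hv.isInner.2.1 hv.isInner.1.1 with h | h
    · exact h ⟨hv.isInner.2, hv.isInner.1, .inr hv⟩
    · exact hv.asymm h
  · rintro h P hP Q hQ v - -
    by_contra! hc
    obtain ⟨-, -, h₁ | h₁⟩ := not_not.1 hc.1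
    · exact hc.2 h₁
    · exact h _ ⟨P, hP, rfl⟩ _ ⟨Q, hQ, rfl⟩ h₁.cw

/-- The edge lists of the routes of a maximal clique. -/
def MaxClique.lists (C : F.MaxClique) : Set (List E) := Path.edges '' C.1

theorem MaxClique.isRoute (C : F.MaxClique) {P : G.Path} (hP : P ∈ C.1) : P.IsRoute :=
  C.2.prop.1 P hP

theorem MaxClique.edges_mem_lists (C : F.MaxClique) {P : G.Path} (hP : P.IsRoute) :
    P.edges ∈ C.lists ↔ P ∈ C.1 := by
  refine ⟨?_, fun h => ⟨P, h, rfl⟩⟩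
  rintro ⟨Q, hQ, h⟩
  exact (C.isRoute hQ).ext hP h ▸ hQ

theorem MaxClique.lists_injective : Function.Injective (MaxClique.lists (F := F)) := by
  refine fun C D h => Subtype.ext (Set.ext fun P => ⟨fun hP => ?_, fun hP => ?_⟩)
  · exact (D.edges_mem_lists (C.isRoute hP)).1 (h ▸ ⟨P, hP, rfl⟩)
  · exact (C.edges_mem_lists (D.isRoute hP)).1 (h ▸ ⟨P, hP, rfl⟩)

theorem MaxClique.isMaxClique_lists (C : F.MaxClique) : F.IsMaxClique C.lists := by
  refine ⟨?_, ?_, fun l hl hcoh => ?_⟩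
  · rintro _ ⟨P, hP, rfl⟩
    exact (C.isRoute hP).isWalk
  · rintro _ ⟨P, hP, rfl⟩ _ ⟨Q, hQ, rfl⟩
    exact (coherent_iff.1 (C.2.prop.2 P hP Q hQ)).1
  · let P : G.Path := ⟨0, Fin.last n, l, hl⟩
    have hP : F.IsClique (insert P C.1) := by
      refine ⟨?_, ?_⟩
      · rintro Q (rfl | hQ)
        · exact ⟨rfl, rfl⟩
        · exact C.isRoute hQ
      · rintro Q (rfl | hQ) Q' (rfl | hQ')
        · exact coherent_iff.2 ⟨not_cw_self hl, not_cw_self hl⟩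
        · exact coherent_iff.2 (hcoh _ ⟨Q', hQ', rfl⟩)
        · exact coherent_iff.2 (hcoh _ ⟨Q, hQ, rfl⟩).symm
        · exact C.2.prop.2 Q hQ Q' hQ'
    exact ⟨P, C.2.le_of_ge hP (Set.subset_insert _ _) (Set.mem_insert _ _), rfl⟩

theorem IsMaxClique.exists_maxClique {S : Set (List E)} (h : F.IsMaxClique S) :
    ∃ C : F.MaxClique, C.lists = S := by
  have hS : Path.edges '' {P : G.Path | P.IsRoute ∧ P.edges ∈ S} = S := by
    refine Set.Subset.antisymm ?_ fun l hl => ?_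
    · rintro _ ⟨P, hP, rfl⟩
      exact hP.2
    · exact ⟨⟨0, Fin.last n, l, h.walk l hl⟩, ⟨⟨rfl, rfl⟩, hl⟩, rfl⟩
  refine ⟨⟨{P | P.IsRoute ∧ P.edges ∈ S}, ⟨fun P hP => hP.1, fun P hP Q hQ => ?_⟩,
    fun T hT hle P hP => ⟨hT.1 P hP, ?_⟩⟩, hS⟩
  · exact coherent_iff.2 ⟨h.not_cw _ hP.2 _ hQ.2, h.not_cw _ hQ.2 _ hP.2⟩
  · refine h.mem _ (hT.1 P hP).isWalk fun l hl => ?_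
    exact coherent_iff.1 (hT.2 P hP ⟨0, Fin.last n, l, h.walk l hl⟩ (hle ⟨⟨rfl, rfl⟩, hl⟩))

/-- All routes of `C` and `D` are then coherent with each other, and maximality makes the cliques
equal. -/
theorem CwFrom.antisymm {C D : F.MaxClique} (h : F.CwFrom C.lists D.lists)
    (h' : F.CwFrom D.lists C.lists) : C = D :=
  MaxClique.lists_injective <| Set.Subset.antisymm
    (fun l hl => D.isMaxClique_lists.mem l (C.isMaxClique_lists.walk l hl)
      fun l' hl' => ⟨h' l' hl' l hl, h l hl l' hl'⟩)
    (fun l hl => C.isMaxClique_lists.mem l (D.isMaxClique_lists.walk l hl)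
      fun l' hl' => ⟨h l' hl' l hl, h' l hl l' hl'⟩)

variable [Finite E]

theorem finite_maxClique : Finite F.MaxClique := by
  have h := G.finite_walks.finite_subsets
  refine Set.finite_univ_iff.1 (Set.Finite.of_finite_image (f := MaxClique.lists)
    (h.subset ?_) MaxClique.lists_injective.injOn)
  rintro _ ⟨C, -, rfl⟩ l hl
  exact ⟨_, _, C.isMaxClique_lists.walk l hl⟩

theorem CcwRotation.cwFrom {C D : F.MaxClique} (h : F.CcwRotation C D) :
    F.CwFrom C.lists D.lists := by
  obtain ⟨-, R, hR, R', hR', hD, v, hv⟩ := h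
  have hC := C.isMaxClique_lists
  have hD' := D.isMaxClique_lists
  refine cwFrom_of_exchange hC hD' ⟨R, hR, rfl⟩ ⟨R', hR', rfl⟩ (fun S => ⟨?_, ?_⟩) hv.cw
  · rintro ⟨⟨P, hP, rfl⟩, hne⟩
    refine ⟨⟨P, hD ▸ .inl ⟨hP, fun h => hne (h ▸ rfl)⟩, rfl⟩, fun h => ?_⟩
    exact hC.not_cw _ ⟨R, hR, rfl⟩ _ ⟨P, hP, rfl⟩ (h ▸ hv.cw)
  · rintro ⟨⟨P, hP, rfl⟩, hne⟩
    refine ⟨⟨P, ?_, rfl⟩, fun h => ?_⟩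
    · rw [hD] at hP
      rcases hP with hP | rfl
      · exact hP.1
      · exact absurd rfl hne
    · exact hD'.not_cw _ ⟨P, hP, rfl⟩ _ ⟨R', hR', rfl⟩ (h ▸ hv.cw)

theorem IsCorner.exists_ccwRotation {C : F.MaxClique} {v : Fin (n + 1)} {a b c d : List E}
    (h : IsCorner F C.lists v a d b c) :
    ∃ D : F.MaxClique, F.CcwRotation C D ∧ D.lists = C.lists \ {a ++ c} ∪ {d ++ b} := by
  have hC := C.isMaxClique_lists
  obtain ⟨D, hD⟩ := (h.isMaxClique hC).exists_maxClique
  let R : G.Path := ⟨0, Fin.last n, a ++ c, h.mid.1.append h.mid.2.1⟩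
  let R' : G.Path := ⟨0, Fin.last n, d ++ b, h.right.1.append h.left.2.1⟩
  have hR : R.IsRoute := ⟨rfl, rfl⟩
  have hR' : R'.IsRoute := ⟨rfl, rfl⟩
  have hRC : R ∈ C.1 := (C.edges_mem_lists hR).1 h.mid.2.2
  have hRD : R' ∈ D.1 := (D.edges_mem_lists hR').1 (hD ▸ .inr rfl)
  refine ⟨D, ⟨?_, R, hRC, R', hRD, ?_, Cw.exists_cwAt h.cw⟩, hD⟩
  · rintro rfl
    exact (coherent_iff.1 (C.2.prop.2 R hRC R' hRD)).1 h.cw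
  · ext P
    refine ⟨fun hP => ?_, ?_⟩
    · have hP' := (D.edges_mem_lists (D.isRoute hP)).2 hP
      rw [hD] at hP'
      rcases hP' with ⟨h₁, h₂⟩ | h₁
      · exact .inl ⟨(C.edges_mem_lists (D.isRoute hP)).1 h₁, fun h => h₂ (h ▸ rfl)⟩
      · exact .inr ((D.isRoute hP).ext hR' h₁)
    · rintro (⟨h₁, h₂⟩ | rfl)
      · refine (D.edges_mem_lists (C.isRoute h₁)).1 ?_
        rw [hD]
        exact .inl ⟨⟨P, h₁, rfl⟩, fun h => h₂ ((C.isRoute h₁).ext hR h)⟩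
      · exact hRD

theorem FramingLE.cwFrom {C D : F.MaxClique} (h : F.FramingLE C D) :
    F.CwFrom C.lists D.lists := by
  induction h with
  | refl => exact fun l hl l' hl' => C.isMaxClique_lists.not_cw l' hl' l hl
  | tail _ h ih =>
    exact ih.trans C.isMaxClique_lists (MaxClique.isMaxClique_lists _)
      (MaxClique.isMaxClique_lists _) h.cwFrom

theorem CwFrom.framingLE {C D : F.MaxClique} (h : F.CwFrom C.lists D.lists) :
    F.FramingLE C D := by
  have hfin : Finite F.MaxClique := finite_maxClique
  -- A rotation shrinks the set of cliques that the current one is cw from: by transitivity nothing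
  -- is gained, and by antisymmetry `C` itself is lost.
  induction hk : {X : F.MaxClique | F.CwFrom C.lists X.lists}.ncard using Nat.strong_induction_on
    generalizing C with
  | _ k ih =>
  by_cases hCD : C = D
  · exact hCD ▸ .refl
  obtain ⟨v, a, d, b, c, hcor, hle⟩ := exists_corner C.isMaxClique_lists D.isMaxClique_lists h
    fun h => hCD (MaxClique.lists_injective h)
  obtain ⟨C₁, hrot, hC₁⟩ := hcor.exists_ccwRotation
  refine .head hrot (ih _ ?_ (hC₁ ▸ hle) rfl)
  rw [← hk]
  refine Set.ncard_lt_ncard ⟨fun X hX => hrot.cwFrom.trans C.isMaxClique_lists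
    C₁.isMaxClique_lists X.isMaxClique_lists hX, fun hs => hrot.1 ?_⟩ (Set.toFinite _)
  exact CwFrom.antisymm hrot.cwFrom
    (hs (FramingLE.cwFrom (.refl : F.FramingLE C C) : F.CwFrom C.lists C.lists))

end Framing
end FlowGraph

theorem mainTheorem2 {n : ℕ} {E : Type*} [Finite E] (G : FlowGraph n E) (F : G.Framing)
    (C C' : F.MaxClique) :
    F.FramingLE C C' ↔ F.IsCwFrom C.1 C'.1 := by
  rw [FlowGraph.Framing.isCwFrom_iff]
  exact ⟨fun h => h.cwFrom, fun h => FlowGraph.Framing.CwFrom.framingLE h⟩
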